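/- Let $\mathfrak g$ be a finite-dimensional complex simple Lie algebra of type $A_n$ ($n\ge1$), $B_n$ ($n\ge2$), $C_n$ ($n\ge2$), $D_n$ ($n\ge4$), $E_6,E_7,E_8,F_4$ or $G_2$ (Bourbaki labelling), with simple roots $\alpha_1,\dots,\alpha_n$, Cartan matrix $C=(c_{ij})$, $c_{ij}=\frac{2(\alpha_i,\alpha_j)}{(\alpha_i,\alpha_i)}$, root lattice $Q=\bigoplus_i\mathbb Z\alpha_i$, fundamental weights $\varpi_i=\sum_k (C^{-1})_{ki}\alpha_k$, weight lattice $\Lambda=\bigoplus_i\mathbb Z\varpi_i$, dominant weights $\Lambda^+=\bigoplus_i\mathbb Z_{\ge0}\varpi_i$ and $\rho=\sum_i\varpi_i$. Let $\ell=1$ for types $B_n,F_4$ and $\ell=2$ otherwise, and normalize the invariant form so that $d_i=(\alpha_i,\alpha_i)/\ell$ are the coprime positive integers with $(d_ic_{ij})$ symmetric. The Euler form is the bilinear form on $Q$ with $\langle\alpha_i,\alpha_j\rangle=d_ic_{ij}$ for $i<j$, $d_i$ for $i=j$, $0$ for $i>j$, except that in type $D_n$ one puts $\langle\alpha_{n-1},\alpha_n\rangle=-1$,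 $\langle\alpha_n,\alpha_{n-1}\rangle=1$. Let $m$ be the least positive integer with $m\Lambda\subseteq Q$, and let $\mathbb K$ be a field of characteristic $0$ containing elements $r,s$ algebraically independent over $\mathbb Q$, with fixed roots $r^{1/m^2},s^{1/m^2}\in\mathbb K$ (used to define the fractional powers below). Put $r_i=r^{d_i}$, $s_i=s^{d_i}$, $a_{ij}=r^{\langle\alpha_j,\alpha_i\rangle}s^{-\langle\alpha_i,\alpha_j\rangle}$. Let $U=U_{r,s}(\mathfrak g)$ be the unital associative $\mathbb K$-algebra generated by $e_i,f_i,\omega_i^{\pm1},\omega_i'^{\pm1}$ $(1\le i\le n)$ with the relations: all $\omega_i^{\pm1},\omega_j'^{\pm1}$ commute with one another and $\omega_i\omega_i^{-1}=\omega_i'\omega_i'^{-1}=1$; $$\omega_ie_j\omega_i^{-1}=a_{ij}e_j,\quad \omega_if_j\omega_i^{-1}=a_{ij}^{-1}f_j,\quad \omega_i'e_j\omega_i'^{-1}=a_{ji}^{-1}e_j,\quad \omega_i'f_j\omega_i'^{-1}=a_{ji}f_j;$$ $$[e_i,f_j]=\delta_{ij}\frac{\omega_i-\omega_i'}{r_i-s_i};\qquad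 (\mathrm{ad}_l e_i)^{1-c_{ij}}(e_j)=0,\quad (\mathrm{ad}_r f_i)^{1-c_{ij}}(f_j)=0\quad(i\ne j),$$ where $\mathrm{ad}_l e_i(y)=e_iy-\omega_iy\omega_i^{-1}e_i$ and $\mathrm{ad}_r f_i(y)=yf_i-f_i\omega_i'^{-1}y\omega_i'$. Its comultiplication $\Delta:U\to U\otimes U$ is the algebra homomorphism for which all $\omega_i^{\pm1},\omega_i'^{\pm1}$ are group-like and $\Delta(e_i)=e_i\otimes1+\omega_i\otimes e_i$, $\Delta(f_i)=1\otimes f_i+f_i\otimes\omega_i'$. For $\mu=\sum_i\mu_i\alpha_i\in\Lambda$ $(\mu_i\in\mathbb Q)$ let $\varrho^\mu$ be the character with $\varrho^\mu(\omega_j)=\prod_ia_{ji}^{\mu_i}$, $\varrho^\mu(\omega'_j)=\prod_ia_{ij}^{-\mu_i}$. Let $M(\lambda)$ be the Verma module of highest weight $\varrho^\lambda$ (the quotient of $U$ by the left ideal generated by all $e_i$, $\omega_i-\varrho^\lambda(\omega_i)$, $\omega_i'-\varrho^\lambda(\omega_i')$) and let $L(\lambda)$ be its unique irreducible quotient. For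 $\lambda\in\Lambda^+$ the module $L(\lambda)$ is finite-dimensional; it is the direct sum of the weight spaces $L(\lambda)_\mu=\{x:\omega_ix=\varrho^\mu(\omega_i)x,\ \omega_i'x=\varrho^\mu(\omega_i')x\ \forall i\}$, $\mu\in\Lambda$. Let $\zeta:U\to\mathrm{End}_{\mathbb K}(L(\lambda))$ be the corresponding representation, and let $\Theta\in\mathrm{End}_{\mathbb K}(L(\lambda))$ be the linear map acting on each $L(\lambda)_\mu$ by the scalar $(rs^{-1})^{-\frac2\ell(\rho,\mu)}$. Let $\mathrm{tr}_2=\mathrm{id}\otimes\mathrm{tr}:U\otimes\mathrm{End}_{\mathbb K}(L(\lambda))\to U$. **Proposition.** Let $\lambda\in\Lambda^+$. If $\Gamma\in U\otimes\mathrm{End}_{\mathbb K}(L(\lambda))$ satisfies $$\Gamma\cdot(\mathrm{id}\otimes\zeta)\Delta(x)=(\mathrm{id}\otimes\zeta)\Delta(x)\cdot\Gamma\qquad\text{for all }x\in U,$$ then $c=\mathrm{tr}_2\big(\Gamma(1\otimes\Theta)\big)$ lies in the center of $U$. -/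

import Mathlib

open scoped TensorProduct

noncomputable section

namespace TwoParameter

/-! ### Finite type data -/

/-- The types of the finite-dimensional complex simple Lie algebras. -/
inductive DynkinType : Type
  | A (n : ℕ) (hn : 1 ≤ n)
  | B (n : ℕ) (hn : 2 ≤ n)
  | C (n : ℕ) (hn : 2 ≤ n)
  | D (n : ℕ) (hn : 4 ≤ n)
  | E6
  | E7
  | E8
  | F4
  | G2

namespace DynkinType

/-- The rank of the simple Lie algebra. -/
def rank : DynkinType → ℕ
  | A n _ => n
  | B n _ => n
  | C n _ => n
  | D n _ => n
  | E6 => 6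
  | E7 => 7
  | E8 => 8
  | F4 => 4
  | G2 => 2

/-- The Cartan matrix `c i j = 2 (α i, α j) / (α i, α i)`. Mathlib's matrices of types `B`, `C` and
`F₄` are written in the transposed convention; its matrix of type `G₂` is not. -/
def cartan : (X : DynkinType) → Matrix (Fin X.rank) (Fin X.rank) ℤ
  | A n _ => CartanMatrix.A n
  | B n _ => (CartanMatrix.B n).transpose
  | C n _ => (CartanMatrix.C n).transpose
  | D n _ => CartanMatrix.D n
  | E6 => CartanMatrix.E₆
  | E7 => CartanMatrix.E₇
  | E8 => CartanMatrix.E₈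
  | F4 => CartanMatrix.F₄.transpose
  | G2 => CartanMatrix.G₂

/-- The symmetrizing integers `d i = (α i, α i) / ℓ`. -/
def d : (X : DynkinType) → Fin X.rank → ℤ
  | A _ _ => fun _ => 1
  | B n _ => fun i => if i.val + 1 = n then 1 else 2
  | C n _ => fun i => if i.val + 1 = n then 2 else 1
  | D _ _ => fun _ => 1
  | E6 => fun _ => 1
  | E7 => fun _ => 1
  | E8 => fun _ => 1
  | F4 => ![2, 2, 1, 1]
  | G2 => ![1, 3]

/-- The normalization constant `ℓ` of the invariant form. -/
def ell : DynkinType → ℚ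
  | B _ _ => 1
  | F4 => 1
  | _ => 2

/-- The Euler form on the simple roots, before the correction in type `D`. -/
def eulerBase (X : DynkinType) (i j : Fin X.rank) : ℤ :=
  if i < j then X.d i * X.cartan i j else if i = j then X.d i else 0

/-- The Euler form `⟨α i, α j⟩` on the simple roots. In type `D` the values on the two spin nodes
are corrected to `⟨n-1, n⟩ = -1` and `⟨n, n-1⟩ = 1`. -/
def euler : (X : DynkinType) → Fin X.rank → Fin X.rank → ℤ
  | D n hn => fun i j =>
      if i.val + 2 = n ∧ j.val + 1 = n then -1
      else if i.val + 1 = n ∧ j.val + 2 = n then 1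
      else eulerBase (D n hn) i j
  | X => eulerBase X

/-- Elements of the weight lattice `Λ`, written in the basis of the fundamental weights. -/
abbrev Weight (X : DynkinType) : Type := Fin X.rank → ℤ

/-- The coordinates, with respect to the simple roots, of a weight; here
`ϖ i = ∑ k, c⁻¹ k i • α k`. -/
def simpleCoord (X : DynkinType) (η : X.Weight) (k : Fin X.rank) : ℚ :=
  ∑ i, (X.cartan.map (Int.cast : ℤ → ℚ))⁻¹ k i * (η i : ℚ)

/-- The least positive integer `m` with `m Λ ⊆ Q`. -/
def latticeIndex (X : DynkinType) : ℕ :=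
  sInf {k : ℕ | 0 < k ∧ ∀ (η : X.Weight) (i : Fin X.rank), ∃ z : ℤ, (k : ℚ) * X.simpleCoord η i = z}

/-- The invariant form `(-,-)` on vectors written in the basis of the simple roots, normalized by
`(α i, α i) = ℓ d i`. -/
def form (X : DynkinType) (x y : Fin X.rank → ℚ) : ℚ :=
  ∑ i, ∑ j, x i * (X.ell / 2 * X.d i * X.cartan i j) * y j

/-- The Weyl vector `ρ`, the sum of the fundamental weights. -/
def rho (X : DynkinType) : X.Weight := fun _ => 1

/-- A weight is dominant if its coordinates in the fundamental weights are nonnegative. -/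
def IsDominant (X : DynkinType) (η : X.Weight) : Prop := ∀ i, 0 ≤ η i

theorem symm_aux (X : DynkinType) (i j : Fin X.rank) :
    X.d i * X.cartan i j = X.d j * X.cartan j i := by
  cases X with
  | A n hn =>
    simp only [rank] at i j
    simp only [d, cartan, CartanMatrix.A, Matrix.of_apply]; grind
  | B n hn =>
    simp only [rank] at i j
    simp only [d, cartan, CartanMatrix.B, Matrix.of_apply, Matrix.transpose_apply]; grind
  | C n hn =>
    simp only [rank] at i j
    simp only [d, cartan, CartanMatrix.C, Matrix.of_apply, Matrix.transpose_apply]; grind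
  | D n hn =>
    simp only [rank] at i j
    simp only [d, cartan, CartanMatrix.D, Matrix.of_apply]; grind
  | E6 => revert i j; decide
  | E7 => revert i j; decide
  | E8 => revert i j; decide
  | F4 => revert i j; decide
  | G2 => revert i j; decide

theorem cartan_diag (X : DynkinType) (i : Fin X.rank) : X.cartan i i = 2 := by
  cases X with
  | A n hn => exact congrFun (CartanMatrix.A_diag n) i
  | B n hn => exact CartanMatrix.B_diag n i
  | C n hn => exact CartanMatrix.C_diag n i
  | D n hn => exact CartanMatrix.D_diag n i
  | E6 => revert i; decide
  | E7 => revert i; decide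
  | E8 => revert i; decide
  | F4 => revert i; decide
  | G2 => revert i; decide

theorem cartan_nonpos (X : DynkinType) {i j : Fin X.rank} (h : i ≠ j) : X.cartan i j ≤ 0 := by
  cases X with
  | A n hn => exact CartanMatrix.A_apply_le_zero_of_ne n i j h
  | B n hn => exact CartanMatrix.B_off_diag_nonpos n j i h.symm
  | C n hn => exact CartanMatrix.C_off_diag_nonpos n j i h.symm
  | D n hn => exact CartanMatrix.D_off_diag_nonpos n i j h
  | E6 => exact CartanMatrix.E₆_off_diag_nonpos i j h
  | E7 => exact CartanMatrix.E₇_off_diag_nonpos i j h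
  | E8 => exact CartanMatrix.E₈_off_diag_nonpos i j h
  | F4 =>
    have key : ∀ i j : Fin 4, i ≠ j → CartanMatrix.F₄.transpose i j ≤ 0 := by
      intro i j
      fin_cases i <;> fin_cases j <;> simp [CartanMatrix.F₄]
    exact key i j h
  | G2 => exact CartanMatrix.G₂_off_diag_nonpos i j h

theorem eulerBase_add (X : DynkinType) (i j : Fin X.rank) :
    X.eulerBase i j + X.eulerBase j i = X.d i * X.cartan i j := by
  have h := X.symm_aux i j
  rcases lt_trichotomy i j with hij | hij | hij
  · simp [eulerBase, hij, hij.not_gt, hij.ne']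
  · subst hij; simp [eulerBase, cartan_diag]; ring
  · simp [eulerBase, hij, hij.not_gt, hij.ne', h]

theorem euler_add (X : DynkinType) (i j : Fin X.rank) :
    X.euler i j + X.euler j i = X.d i * X.cartan i j := by
  cases X with
  | D n hn =>
    have h := eulerBase_add (D n hn) i j
    simp only [rank] at i j
    simp only [euler]
    by_cases h1 : i.val + 2 = n ∧ j.val + 1 = n
    · have h2 : ¬ (i.val + 1 = n ∧ j.val + 2 = n) := by omega
      have h3 : ¬ (j.val + 2 = n ∧ i.val + 1 = n) := by omega
      have h4 : (j.val + 1 = n ∧ i.val + 2 = n) := by omega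
      simp only [h1, h3]
      simp only [d, cartan, CartanMatrix.D, Matrix.of_apply]; grind
    · by_cases h2 : i.val + 1 = n ∧ j.val + 2 = n
      · have h3 : (j.val + 2 = n ∧ i.val + 1 = n) := by omega
        simp only [h1, h2]
        simp only [d, cartan, CartanMatrix.D, Matrix.of_apply]; grind
      · have h3 : ¬ (j.val + 2 = n ∧ i.val + 1 = n) := by omega
        have h4 : ¬ (j.val + 1 = n ∧ i.val + 2 = n) := by omega
        simp only [h1, h2, h3, h4, if_false]
        exact h
  | _ => exact eulerBase_add _ i j

theorem euler_self (X : DynkinType) (i : Fin X.rank) : X.euler i i = X.d i := by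
  have h := X.euler_add i i
  rw [cartan_diag] at h
  omega

/-- Extension of a vector by zero. -/
def ext0 {n : ℕ} (v : Fin n → ℚ) (k : ℕ) : ℚ := if h : k < n then v ⟨k, h⟩ else 0

theorem sum_ext0 {n : ℕ} (v : Fin n → ℚ) (k : ℕ) :
    ∑ j : Fin n, (if j.val = k then v j else 0) = ext0 v k := by
  unfold ext0
  split_ifs with h
  · rw [Finset.sum_eq_single ⟨k, h⟩]
    · simp
    · intro b _ hb
      rw [if_neg]
      exact fun h' => hb (Fin.ext h')
    · simp
  · apply Finset.sum_eq_zero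
    intro j _
    rw [if_neg]
    omega

theorem ext0_linear (u : ℕ → ℚ) (N : ℕ) (h0 : 0 < N → u 1 = 2 * u 0)
    (h : ∀ k, k + 1 < N → u (k + 2) = 2 * u (k + 1) - u k) :
    ∀ k, k ≤ N → u k = (k + 1) * u 0 := by
  intro k
  induction k using Nat.strong_induction_on with
  | _ k ih =>
    intro hk
    match k with
    | 0 => simp
    | 1 => rw [h0 (by omega)]; norm_num
    | k + 2 =>
      rw [h k (by omega), ih (k + 1) (by omega) (by omega), ih k (by omega) (by omega)]
      push_cast; ring

theorem det_ne_zero_of_ker {n : ℕ} (M : Matrix (Fin n) (Fin n) ℤ)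
    (h : ∀ v : Fin n → ℚ, (∀ i, ∑ j, (M i j : ℚ) * v j = 0) → ext0 v 0 = 0 → v = 0)
    (h0 : ∀ v : Fin n → ℚ, (∀ i, ∑ j, (M i j : ℚ) * v j = 0) → ext0 v 0 = 0) : M.det ≠ 0 := by
  intro hd
  have hd' : (M.map (Int.cast : ℤ → ℚ)).det = 0 := by
    have := (Int.castRingHom ℚ).map_det M
    rw [hd] at this
    simpa using this.symm
  obtain ⟨v, hv, hv'⟩ := Matrix.exists_mulVec_eq_zero_iff.mpr hd'
  apply hv
  have hk : ∀ i, ∑ j, (M i j : ℚ) * v j = 0 := fun i => by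
    simpa [Matrix.mulVec, dotProduct] using congrFun hv' i
  exact h v hk (h0 v hk)

theorem row_sum {n : ℕ} (M : Matrix (Fin n) (Fin n) ℤ) (v : Fin n → ℚ) (i : Fin n)
    (f : ℕ → ℚ) (s : Finset ℕ) (hM : ∀ j : Fin n, (M i j : ℚ) = ∑ k ∈ s, if j.val = k then f k else 0) :
    ∑ j, (M i j : ℚ) * v j = ∑ k ∈ s, f k * ext0 v k := by
  simp only [← sum_ext0, hM, Finset.sum_mul, Finset.mul_sum]
  rw [Finset.sum_comm]
  refine Finset.sum_congr rfl fun k _ => Finset.sum_congr rfl fun j _ => ?_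
  split_ifs <;> simp

theorem det_A (n : ℕ) (hn : 1 ≤ n) : (CartanMatrix.A n).det ≠ 0 := by
  have key : ∀ v : Fin n → ℚ, (∀ i, ∑ j, (CartanMatrix.A n i j : ℚ) * v j = 0) →
      ∀ k, k ≤ n → ext0 v k = (k + 1) * ext0 v 0 := by
    intro v hv
    apply ext0_linear
    · intro _
      have h := hv ⟨0, hn⟩
      rw [row_sum _ _ _ (fun k => if k = 0 then 2 else -1) {0, 1}] at h
      · simp at h; linarith
      · intro j
        simp [CartanMatrix.A, Fin.ext_iff]; grind
    · intro k hk
      have h := hv ⟨k + 1, hk⟩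
      rw [row_sum _ _ _ (fun l => if l = k + 1 then 2 else -1) {k, k + 1, k + 2}] at h
      · simp at h; linarith
      · intro j
        simp [CartanMatrix.A, Fin.ext_iff]; grind
  have hz : ∀ v : Fin n → ℚ, ext0 v n = 0 := fun v => by simp [ext0]
  apply det_ne_zero_of_ker
  · intro v hv h0
    ext i
    have := key v hv i i.2.le
    rw [h0] at this
    simpa [ext0] using this
  · intro v hv
    have := key v hv n le_rfl
    rw [hz] at this
    have h2 : (n : ℚ) + 1 ≠ 0 := by positivity
    simpa [h2] using this.symm

theorem det_B (n : ℕ) (hn : 2 ≤ n) : (CartanMatrix.B n).det ≠ 0 := by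
  obtain ⟨p, rfl⟩ : ∃ p, n = p + 2 := ⟨n - 2, by omega⟩
  have key : ∀ v : Fin (p + 2) → ℚ, (∀ i, ∑ j, (CartanMatrix.B (p + 2) i j : ℚ) * v j = 0) →
      ∀ k, k ≤ p + 1 → (fun l => if l = p + 1 then 2 * ext0 v l else ext0 v l) k = (k + 1) *
        (fun l => if l = p + 1 then 2 * ext0 v l else ext0 v l) 0 := by
    intro v hv
    apply ext0_linear
    · intro _
      have h := hv ⟨0, by omega⟩
      rw [row_sum _ _ _ (fun k => if k = 0 then 2 else if k = p + 1 then -2 else -1) {0, 1}] at h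
      · by_cases hp : p = 0
        · subst hp; simp at h ⊢; linarith
        · have : (1 : ℕ) ≠ p + 1 := by omega
          simp [hp] at h ⊢; linarith
      · intro j
        rw [Finset.sum_pair (by omega)]
        simp only [CartanMatrix.B, Matrix.of_apply, Fin.ext_iff]; push_cast; grind
    · intro k hk
      have h := hv ⟨k + 1, by omega⟩
      rw [row_sum _ _ _ (fun l => if l = k + 1 then 2 else if l = p + 1 then -2 else -1)
        {k, k + 1, k + 2}] at h
      · have h1 : k + 1 ≠ p + 1 := by omega
        have h2 : k ≠ p + 1 := by omega
        have h2' : k ≠ p := by omega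
        by_cases hp : k + 2 = p + 1
        · obtain rfl : p = k + 1 := by omega
          simp at h ⊢
          rw [if_neg h2] at h ⊢
          linarith
        · have hp' : k + 1 ≠ p := by omega
          simp [h2, h2', hp'] at h ⊢; linarith
      · intro j
        simp [CartanMatrix.B, Fin.ext_iff]; grind
  have last : ∀ v : Fin (p + 2) → ℚ, (∀ i, ∑ j, (CartanMatrix.B (p + 2) i j : ℚ) * v j = 0) →
      2 * ext0 v (p + 1) = ext0 v p := by
    intro v hv
    have h := hv ⟨p + 1, by omega⟩
    rw [row_sum _ _ _ (fun l => if l = p + 1 then 2 else -1) {p, p + 1}] at h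
    · simp at h; linarith
    · intro j
      simp [CartanMatrix.B, Fin.ext_iff]; grind
  apply det_ne_zero_of_ker
  · intro v hv h0
    ext i
    have := key v hv i (by omega)
    simp only [h0] at this
    have h3 : ext0 v i = v i := by simp [ext0]
    rw [h3] at this
    simp only [mul_zero, ite_self] at this
    split_ifs at this
    · have h4 : (2 : ℚ) * v i = 0 := this
      simpa using h4
    · simpa using this
  · intro v hv
    have h1 := key v hv (p + 1) le_rfl
    have h2 := key v hv p (by omega)
    have h3 := last v hv
    simp at h1 h2
    linarith

theorem det_D (n : ℕ) (hn : 4 ≤ n) : (CartanMatrix.D n).det ≠ 0 := by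
  obtain ⟨p, rfl⟩ : ∃ p, n = p + 4 := ⟨n - 4, by omega⟩
  have key : ∀ v : Fin (p + 4) → ℚ, (∀ i, ∑ j, (CartanMatrix.D (p + 4) i j : ℚ) * v j = 0) →
      ∀ k, k ≤ p + 1 → ext0 v k = (k + 1) * ext0 v 0 := by
    intro v hv
    apply ext0_linear
    · intro _
      have h := hv ⟨0, by omega⟩
      rw [row_sum _ _ _ (fun k => if k = 0 then 2 else -1) {0, 1}] at h
      · simp at h; linarith
      · intro j
        rw [Finset.sum_pair (by omega)]
        simp only [CartanMatrix.D, Matrix.of_apply, Fin.ext_iff]; push_cast; grind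
    · intro k hk
      have h := hv ⟨k + 1, by omega⟩
      rw [row_sum _ _ _ (fun l => if l = k + 1 then 2 else -1) {k, k + 1, k + 2}] at h
      · simp at h; linarith
      · intro j
        simp [CartanMatrix.D, Fin.ext_iff]; grind
  have l1 : ∀ v : Fin (p + 4) → ℚ, (∀ i, ∑ j, (CartanMatrix.D (p + 4) i j : ℚ) * v j = 0) →
      2 * ext0 v (p + 1) = ext0 v p + ext0 v (p + 2) + ext0 v (p + 3) := by
    intro v hv
    have h := hv ⟨p + 1, by omega⟩
    rw [row_sum _ _ _ (fun l => if l = p + 1 then 2 else -1) {p, p + 1, p + 2, p + 3}] at h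
    · simp at h; linarith
    · intro j
      simp [CartanMatrix.D, Fin.ext_iff]; grind
  have l2 : ∀ v : Fin (p + 4) → ℚ, (∀ i, ∑ j, (CartanMatrix.D (p + 4) i j : ℚ) * v j = 0) →
      2 * ext0 v (p + 2) = ext0 v (p + 1) := by
    intro v hv
    have h := hv ⟨p + 2, by omega⟩
    rw [row_sum _ _ _ (fun l => if l = p + 2 then 2 else -1) {p + 1, p + 2}] at h
    · simp at h; linarith
    · intro j
      simp [CartanMatrix.D, Fin.ext_iff]; grind
  have l3 : ∀ v : Fin (p + 4) → ℚ, (∀ i, ∑ j, (CartanMatrix.D (p + 4) i j : ℚ) * v j = 0) →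
      2 * ext0 v (p + 3) = ext0 v (p + 1) := by
    intro v hv
    have h := hv ⟨p + 3, by omega⟩
    rw [row_sum _ _ _ (fun l => if l = p + 3 then 2 else -1) {p + 1, p + 3}] at h
    · simp at h; linarith
    · intro j
      simp [CartanMatrix.D, Fin.ext_iff]; grind
  apply det_ne_zero_of_ker
  · intro v hv h0
    ext i
    have h3 : ext0 v i = v i := by simp [ext0]
    have k1 := key v hv
    simp only [h0, mul_zero] at k1
    have e1 := l2 v hv
    have e2 := l3 v hv
    rw [k1 (p + 1) le_rfl] at e1 e2
    rw [← h3]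
    have hi : i.val ≤ p + 1 ∨ i.val = p + 2 ∨ i.val = p + 3 := by omega
    rcases hi with hi | hi | hi
    · exact k1 _ hi
    · rw [hi]; simpa using e1
    · rw [hi]; simpa using e2
  · intro v hv
    have h1 := key v hv (p + 1) le_rfl
    have h2 := key v hv p (by omega)
    have h3 := l1 v hv
    have h4 := l2 v hv
    have h5 := l3 v hv
    push_cast at h1
    linarith

theorem det_cartan_ne_zero (X : DynkinType) : X.cartan.det ≠ 0 := by
  cases X with
  | A n hn => exact det_A n hn
  | B n hn => exact (Matrix.det_transpose _).trans_ne (det_B n hn)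
  | C n hn =>
    refine (Matrix.det_transpose _).trans_ne ?_
    have h : (CartanMatrix.C n).det = (CartanMatrix.B n).det := by
      rw [← CartanMatrix.B_transpose, Matrix.det_transpose]
    exact h.trans_ne (det_B n hn)
  | D n hn => exact det_D n hn
  | E6 => exact CartanMatrix.E₆_det.trans_ne (by norm_num)
  | E7 => exact CartanMatrix.E₇_det.trans_ne (by norm_num)
  | E8 => exact CartanMatrix.E₈_det.trans_ne (by norm_num)
  | F4 => exact ((Matrix.det_transpose _).trans CartanMatrix.F₄_det).trans_ne (by norm_num)
  | G2 => exact CartanMatrix.G₂_det.trans_ne (by norm_num)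

theorem isUnit_det_cartan (X : DynkinType) :
    IsUnit (X.cartan.map (Int.cast : ℤ → ℚ)).det := by
  have h : (X.cartan.map (Int.cast : ℤ → ℚ)).det = (X.cartan.det : ℚ) :=
    ((Int.castRingHom ℚ).map_det X.cartan).symm
  rw [h, isUnit_iff_ne_zero]
  exact_mod_cast X.det_cartan_ne_zero

theorem simpleCoord_eq (X : DynkinType) (η : X.Weight) :
    X.simpleCoord η = (X.cartan.map (Int.cast : ℤ → ℚ))⁻¹.mulVec (fun i => (η i : ℚ)) := rfl

theorem simpleCoord_add (X : DynkinType) (η μ : X.Weight) :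
    X.simpleCoord (η + μ) = X.simpleCoord η + X.simpleCoord μ := by
  funext k
  simp [simpleCoord, mul_add, Finset.sum_add_distrib]

theorem simpleCoord_neg (X : DynkinType) (η : X.Weight) :
    X.simpleCoord (-η) = -X.simpleCoord η := by
  funext k
  simp [simpleCoord]

theorem simpleCoord_injective (X : DynkinType) : Function.Injective X.simpleCoord := by
  intro η μ h
  rw [simpleCoord_eq, simpleCoord_eq] at h
  have h2 := congrArg (X.cartan.map (Int.cast : ℤ → ℚ)).mulVec h
  simp only [Matrix.mulVec_mulVec, Matrix.mul_nonsing_inv _ X.isUnit_det_cartan,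
    Matrix.one_mulVec] at h2
  funext i
  exact_mod_cast congrFun h2 i

/-- The simple root `α j = ∑ i, c i j • ϖ i` as a weight. -/
def simpleRoot (X : DynkinType) (j : Fin X.rank) : X.Weight := fun i => X.cartan i j

theorem simpleCoord_simpleRoot (X : DynkinType) (j k : Fin X.rank) :
    X.simpleCoord (X.simpleRoot j) k = if k = j then 1 else 0 := by
  have h := congrFun (congrFun (Matrix.nonsing_inv_mul _ X.isUnit_det_cartan) k) j
  rw [Matrix.mul_apply, Matrix.one_apply] at h
  rw [← h]
  rfl

theorem cartan_simpleCoord (X : DynkinType) (η : X.Weight) (i : Fin X.rank) :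
    ∑ j, (X.cartan i j : ℚ) * X.simpleCoord η j = η i := by
  have h := congrArg (X.cartan.map (Int.cast : ℤ → ℚ)).mulVec (X.simpleCoord_eq η)
  simp only [Matrix.mulVec_mulVec, Matrix.mul_nonsing_inv _ X.isUnit_det_cartan,
    Matrix.one_mulVec] at h
  exact congrFun h i

theorem latticeIndex_spec (X : DynkinType) :
    0 < X.latticeIndex ∧ ∀ (η : X.Weight) (i : Fin X.rank),
      ∃ z : ℤ, (X.latticeIndex : ℚ) * X.simpleCoord η i = z := by
  apply Nat.sInf_mem (s := {k : ℕ | 0 < k ∧ ∀ (η : X.Weight) (i : Fin X.rank),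
    ∃ z : ℤ, (k : ℚ) * X.simpleCoord η i = z})
  refine ⟨X.cartan.det.natAbs, Int.natAbs_pos.mpr X.det_cartan_ne_zero, fun η i => ?_⟩
  have key : ∃ z : ℤ, (X.cartan.det : ℚ) * X.simpleCoord η i = z := by
    refine ⟨X.cartan.adjugate.mulVec η i, ?_⟩
    have h := congrArg (X.cartan.adjugate.map (Int.cast : ℤ → ℚ)).mulVec
      (funext (X.cartan_simpleCoord η))
    have h2 : (X.cartan.adjugate.map (Int.cast : ℤ → ℚ)) * X.cartan.map (Int.cast : ℤ → ℚ)
        = (X.cartan.det : ℚ) • (1 : Matrix (Fin X.rank) (Fin X.rank) ℚ) := by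
      have h3 := congrArg (fun M : Matrix (Fin X.rank) (Fin X.rank) ℤ =>
        M.map (Int.castRingHom ℚ)) (Matrix.adjugate_mul X.cartan)
      simp only [Matrix.map_mul] at h3
      refine h3.trans ?_
      ext a b
      simp only [Matrix.map_apply, Matrix.smul_apply, Matrix.one_apply, smul_eq_mul]
      split_ifs <;> simp
    have h4 : (X.cartan.adjugate.map (Int.cast : ℤ → ℚ)).mulVec
        ((X.cartan.map (Int.cast : ℤ → ℚ)).mulVec (X.simpleCoord η))
        = (X.cartan.adjugate.map (Int.cast : ℤ → ℚ)).mulVec (fun i => (η i : ℚ)) := h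
    rw [Matrix.mulVec_mulVec, h2, Matrix.smul_mulVec, Matrix.one_mulVec] at h4
    have h5 := congrFun h4 i
    simp only [Pi.smul_apply, smul_eq_mul] at h5
    rw [h5]
    simp [Matrix.mulVec, dotProduct]
  obtain ⟨z, hz⟩ := key
  rcases Int.natAbs_eq X.cartan.det with h | h
  · refine ⟨z, ?_⟩
    have h2 : ((X.cartan.det.natAbs : ℕ) : ℚ) = (X.cartan.det : ℚ) := by
      rw [← Int.cast_natCast, ← h]
    rw [← hz, h2]
  · refine ⟨-z, ?_⟩
    have h2 : ((X.cartan.det.natAbs : ℕ) : ℚ) = -(X.cartan.det : ℚ) := by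
      have h3 : ((X.cartan.det.natAbs : ℕ) : ℤ) = -X.cartan.det := by omega
      rw [← Int.cast_natCast, h3, Int.cast_neg]
    push_cast
    rw [← hz, h2]
    ring

theorem d_pos (X : DynkinType) (i : Fin X.rank) : 0 < X.d i := by
  cases X with
  | A n hn => exact one_pos
  | B n hn => simp only [d]; split_ifs <;> norm_num
  | C n hn => simp only [d]; split_ifs <;> norm_num
  | D n hn => exact one_pos
  | E6 => exact one_pos
  | E7 => exact one_pos
  | E8 => exact one_pos
  | F4 => revert i; decide
  | G2 => revert i; decide

end DynkinType

/-! ### The ground field -/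

/-- The ground field: `r` and `s` are elements of `K` which are algebraically independent over `ℚ`,
so that `K` contains `ℚ(r, s)`, together with chosen roots `r^(1/m²)` and `s^(1/m²)` in `K`. -/
structure Parameters (X : DynkinType) (K : Type*) [Field K] [CharZero K] where
  r : K
  s : K
  algebraicIndependent : AlgebraicIndependent ℚ ![r, s]
  rRoot : K
  sRoot : K
  rRoot_pow : rRoot ^ (X.latticeIndex ^ 2) = r
  sRoot_pow : sRoot ^ (X.latticeIndex ^ 2) = s

/-- The fractional power `b ^ x`, where `b₀` is the chosen root with `b₀ ^ (m²) = b` and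
`x` is a rational number with `m² x` an integer. -/
def fracPow (X : DynkinType) {K : Type*} [Field K] (b₀ : K) (x : ℚ) : K :=
  b₀ ^ ⌊x * (X.latticeIndex : ℚ) ^ 2⌋

namespace Parameters

variable {X : DynkinType} {K : Type*} [Field K] [CharZero K] (P : Parameters X K)

/-- The structure constants `a i j = r ^ ⟨j, i⟩ * s ^ (-⟨i, j⟩)`. -/
def a (i j : Fin X.rank) : K := P.r ^ X.euler j i * P.s ^ (-X.euler i j)

/-- The chosen `m²`-th root of the structure constant `a i j`. -/
def aRoot (i j : Fin X.rank) : K := P.rRoot ^ X.euler j i * P.sRoot ^ (-X.euler i j)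

theorem r_ne_zero : P.r ≠ 0 := by
  simpa using P.algebraicIndependent.ne_zero 0

theorem s_ne_zero : P.s ≠ 0 := by
  simpa using P.algebraicIndependent.ne_zero 1

theorem a_ne_zero (i j : Fin X.rank) : P.a i j ≠ 0 :=
  mul_ne_zero (zpow_ne_zero _ P.r_ne_zero) (zpow_ne_zero _ P.s_ne_zero)

theorem a_mul_a (i j : Fin X.rank) (hij : i ≠ j) :
    P.a i j * P.a j i * P.a i i ^ (-X.cartan i j).toNat = 1 := by
  have h1 : P.a i j * P.a j i = P.a i i ^ (X.cartan i j) := by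
    have h := X.euler_add i j
    have h' := X.euler_self i
    simp only [a, mul_zpow, ← zpow_mul, h']
    rw [mul_mul_mul_comm, ← zpow_add₀ P.r_ne_zero, ← zpow_add₀ P.s_ne_zero, add_comm, h]
    congr 2
    rw [← neg_add, h]; ring
  have h2 : (((-X.cartan i j).toNat : ℕ) : ℤ) = -X.cartan i j :=
    Int.toNat_of_nonneg (by have := X.cartan_nonpos hij; omega)
  rw [h1, ← zpow_natCast, h2, ← zpow_add₀ (P.a_ne_zero i i)]
  simp

end Parameters

/-! ### Auxiliary identities for the quantum Serre elements -/

section Skew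

variable {K : Type*} [Field K]

/-- Gaussian binomial coefficients `[p + l choose p]`. -/
def gaussAux (q : K) : ℕ → ℕ → K
  | 0, _ => 1
  | _ + 1, 0 => 1
  | p + 1, l + 1 => q ^ (p + 1) * gaussAux q (p + 1) l + gaussAux q p (l + 1)

theorem gaussAux_succ (q : K) (p l : ℕ) : gaussAux q (p + 1) (l + 1) =
    q ^ (p + 1) * gaussAux q (p + 1) l + gaussAux q p (l + 1) := by
  rw [gaussAux]

theorem gaussAux_zero_left (q : K) (l : ℕ) : gaussAux q 0 l = 1 := by cases l <;> rw [gaussAux]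

theorem gaussAux_zero_right (q : K) (p : ℕ) : gaussAux q p 0 = 1 := by cases p <;> rw [gaussAux]

theorem gaussAux_succ' (q : K) (p l : ℕ) : gaussAux q (p + 1) (l + 1) =
    gaussAux q (p + 1) l + q ^ (l + 1) * gaussAux q p (l + 1) := by
  induction p generalizing l with
  | zero =>
    induction l with
    | zero => simp [gaussAux_succ, gaussAux_zero_left, gaussAux_zero_right]; ring
    | succ l ih =>
      rw [gaussAux_succ, ih]
      simp only [gaussAux_zero_left] at ih ⊢
      have h := gaussAux_succ q 0 l
      simp only [gaussAux_zero_left] at h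
      have := h.symm.trans ih
      linear_combination this
  | succ p ihp =>
    induction l with
    | zero =>
      have h := ihp 0
      have h' := gaussAux_succ q p 0
      rw [gaussAux_succ, h']
      simp only [gaussAux_zero_right] at h h' ⊢
      have := h'.symm.trans h
      linear_combination this
    | succ l ihl =>
      rw [gaussAux_succ q (p + 1) (l + 1)]
      have h1 := ihl
      have h2 := ihp (l + 1)
      have h3 := gaussAux_succ q (p + 1) l
      have h4 := gaussAux_succ q p (l + 1)
      linear_combination q ^ (p + 2) * h1 + h2 - h3 - q ^ (l + 2) * h4

variable {T : Type*} [Ring T] [Algebra K T]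

/-- The iterated `q`-commutator `y ↦ x y - a q^k y x`. -/
def qad (q a : K) (x y : T) : ℕ → T
  | 0 => y
  | k + 1 => x * qad q a x y k - (a * q ^ k) • (qad q a x y k * x)

/-- Coefficients of the mixed terms in the coproduct of `qad`. -/
def mixAux (q c : K) (p l : ℕ) : K := gaussAux q p l * ∏ t ∈ Finset.range p, (1 - c * q ^ (l + t))

theorem mixAux_rec (q c : K) (p l : ℕ) : mixAux q c (p + 1) (l + 1) =
    q ^ (p + 1) * mixAux q c (p + 1) l + (1 - c * q ^ (2 * (l + 1) + p)) * mixAux q c p (l + 1) := by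
  have e1 := Finset.prod_range_succ (fun t => (1 - c * q ^ ((l + 1) + t))) p
  have e2 := Finset.prod_range_succ' (fun t => (1 - c * q ^ (l + t))) p
  simp only [mixAux]
  have e3 : ∏ t ∈ Finset.range p, (1 - c * q ^ (l + (t + 1)))
      = ∏ t ∈ Finset.range p, (1 - c * q ^ ((l + 1) + t)) :=
    Finset.prod_congr rfl fun t _ => by rw [add_right_comm, add_assoc]
  rw [e1, e2, e3]
  have h1 := gaussAux_succ q p l
  have h2 := gaussAux_succ' q p l
  set Z := ∏ t ∈ Finset.range p, (1 - c * q ^ ((l + 1) + t))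
  linear_combination Z * h1 - Z * c * q ^ (l + 1 + p) * h2

theorem mixAux_zero_left (q c : K) (l : ℕ) : mixAux q c 0 l = 1 := by
  simp [mixAux, gaussAux_zero_left]

theorem mixAux_rec_zero (q c : K) (p : ℕ) : mixAux q c (p + 1) 0 =
    (1 - c * q ^ p) * mixAux q c p 0 := by
  simp only [mixAux, gaussAux_zero_right, Finset.prod_range_succ]
  simp [mul_comm]

theorem qad_skew (q a b : K) (x₁ y₁ k₁ j₁ x₂ y₂ : T)
    (hkx : k₁ * x₁ = q • (x₁ * k₁)) (hky : k₁ * y₁ = a • (y₁ * k₁)) (hjx : j₁ * x₁ = b • (x₁ * j₁))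
    (hjk : j₁ * k₁ = k₁ * j₁)
    (cxx : Commute x₂ x₁) (cxy : Commute x₂ y₁) (cxk : Commute x₂ k₁) (cxj : Commute x₂ j₁)
    (cyx : Commute y₂ x₁) (cyk : Commute y₂ k₁) (n : ℕ) :
    qad q a (x₁ + k₁ * x₂) (y₁ + j₁ * y₂) n = qad q a x₁ y₁ n +
      ∑ p ∈ Finset.HasAntidiagonal.antidiagonal n, mixAux q (a * b) p.1 p.2 •
        (x₁ ^ p.1 * k₁ ^ p.2 * j₁ * qad q a x₂ y₂ p.2) := by
  have hkz : ∀ n, k₁ * qad q a x₁ y₁ n = (a * q ^ n) • (qad q a x₁ y₁ n * k₁) := by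
    intro n
    induction n with
    | zero => simpa [qad] using hky
    | succ n ih =>
      simp only [qad, mul_sub, sub_mul, mul_smul_comm, smul_mul_assoc, smul_sub]
      have e1 : k₁ * (x₁ * qad q a x₁ y₁ n) = (a * q ^ (n + 1)) • (x₁ * qad q a x₁ y₁ n * k₁) := by
        rw [← mul_assoc, hkx, smul_mul_assoc, mul_assoc, ih, mul_smul_comm, smul_smul, mul_assoc]
        congr 1; ring
      have e2 : k₁ * (qad q a x₁ y₁ n * x₁) = (a * q ^ (n + 1)) • (qad q a x₁ y₁ n * x₁ * k₁) := by
        rw [← mul_assoc, ih, smul_mul_assoc, mul_assoc, hkx, mul_smul_comm, smul_smul, ← mul_assoc]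
        congr 1; ring
      rw [e1, e2, smul_smul, smul_smul]
      congr 2; ring
  have cz : ∀ n, Commute x₂ (qad q a x₁ y₁ n) := by
    intro n
    induction n with
    | zero => exact cxy
    | succ n ih => exact (cxx.mul_right ih).sub_right ((ih.mul_right cxx).smul_right _)
  have cw : ∀ n, Commute (qad q a x₂ y₂ n) x₁ := by
    intro n
    induction n with
    | zero => exact cyx
    | succ n ih => exact (cxx.mul_left ih).sub_left ((ih.mul_left cxx).smul_left _)
  have cwk : ∀ n, Commute (qad q a x₂ y₂ n) k₁ := by
    intro n
    induction n with
    | zero => exact cyk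
    | succ n ih => exact (cxk.mul_left ih).sub_left ((ih.mul_left cxk).smul_left _)
  have hkxp : ∀ p, k₁ * x₁ ^ p = q ^ p • (x₁ ^ p * k₁) := by
    intro p
    induction p with
    | zero => simp
    | succ p ih =>
      rw [pow_succ, ← mul_assoc, ih, smul_mul_assoc, mul_assoc, hkx, mul_smul_comm, smul_smul,
        pow_succ, mul_assoc]
  have hkpx : ∀ l, k₁ ^ l * x₁ = q ^ l • (x₁ * k₁ ^ l) := by
    intro l
    induction l with
    | zero => simp
    | succ l ih =>
      rw [pow_succ, mul_assoc, hkx, mul_smul_comm, ← mul_assoc, ih, smul_mul_assoc, smul_smul,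
        mul_assoc, pow_succ, mul_comm]
  -- one step applied to a mixed term
  have step : ∀ p l, (x₁ + k₁ * x₂) * (x₁ ^ p * k₁ ^ l * j₁ * qad q a x₂ y₂ l)
      - (a * q ^ (p + l)) • ((x₁ ^ p * k₁ ^ l * j₁ * qad q a x₂ y₂ l) * (x₁ + k₁ * x₂))
      = (1 - a * b * q ^ (2 * l + p)) • (x₁ ^ (p + 1) * k₁ ^ l * j₁ * qad q a x₂ y₂ l)
        + q ^ p • (x₁ ^ p * k₁ ^ (l + 1) * j₁ * qad q a x₂ y₂ (l + 1)) := by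
    intro p l
    set w := qad q a x₂ y₂ l with hw
    have t1 : x₁ * (x₁ ^ p * k₁ ^ l * j₁ * w) = x₁ ^ (p + 1) * k₁ ^ l * j₁ * w := by
      rw [pow_succ']; simp only [mul_assoc]
    have t2 : k₁ * x₂ * (x₁ ^ p * k₁ ^ l * j₁ * w)
        = q ^ p • (x₁ ^ p * k₁ ^ (l + 1) * j₁ * (x₂ * w)) := by
      have c : Commute x₂ (x₁ ^ p * k₁ ^ l * j₁) :=
        ((cxx.pow_right p).mul_right (cxk.pow_right l)).mul_right cxj
      calc k₁ * x₂ * (x₁ ^ p * k₁ ^ l * j₁ * w)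
          = k₁ * (x₂ * (x₁ ^ p * k₁ ^ l * j₁)) * w := by simp only [mul_assoc]
        _ = (k₁ * x₁ ^ p) * k₁ ^ l * j₁ * (x₂ * w) := by rw [c.eq]; simp only [mul_assoc]
        _ = _ := by
          rw [hkxp, pow_succ']; simp only [mul_assoc, smul_mul_assoc]
    have t3 : x₁ ^ p * k₁ ^ l * j₁ * w * x₁
        = (b * q ^ l) • (x₁ ^ (p + 1) * k₁ ^ l * j₁ * w) := by
      calc x₁ ^ p * k₁ ^ l * j₁ * w * x₁ = x₁ ^ p * k₁ ^ l * j₁ * (w * x₁) := by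
            simp only [mul_assoc]
        _ = x₁ ^ p * k₁ ^ l * (j₁ * x₁) * w := by rw [show w * x₁ = x₁ * w from (cw l).eq]; simp only [mul_assoc]
        _ = b • (x₁ ^ p * (k₁ ^ l * x₁) * j₁ * w) := by
          rw [hjx]; simp only [mul_assoc, smul_mul_assoc, mul_smul_comm]
        _ = _ := by
          rw [hkpx, pow_succ]; simp only [mul_assoc, smul_mul_assoc, mul_smul_comm, smul_smul]
    have t4 : x₁ ^ p * k₁ ^ l * j₁ * w * (k₁ * x₂) = x₁ ^ p * k₁ ^ (l + 1) * j₁ * (w * x₂) := by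
      calc x₁ ^ p * k₁ ^ l * j₁ * w * (k₁ * x₂) = x₁ ^ p * k₁ ^ l * j₁ * (w * k₁) * x₂ := by
            simp only [mul_assoc]
        _ = x₁ ^ p * k₁ ^ l * (j₁ * k₁) * (w * x₂) := by
          rw [show w * k₁ = k₁ * w from (cwk l).eq]; simp only [mul_assoc]
        _ = _ := by rw [hjk, pow_succ]; simp only [mul_assoc]
    rw [add_mul, mul_add, t1, t2, t3, t4]
    simp only [qad, ← hw, mul_sub, mul_smul_comm, smul_sub, smul_add, smul_smul, sub_smul, one_smul]
    have e1 : a * q ^ (p + l) * (b * q ^ l) = a * b * q ^ (2 * l + p) := by ring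
    have e2 : q ^ p * (a * q ^ l) = a * q ^ (p + l) := by ring
    rw [e1, e2]
    abel
  have first : ∀ n, (x₁ + k₁ * x₂) * qad q a x₁ y₁ n
      - (a * q ^ n) • (qad q a x₁ y₁ n * (x₁ + k₁ * x₂)) = qad q a x₁ y₁ (n + 1) := by
    intro n
    have e : qad q a x₁ y₁ n * (k₁ * x₂) = qad q a x₁ y₁ n * k₁ * x₂ := by rw [mul_assoc]
    have e' : k₁ * x₂ * qad q a x₁ y₁ n = (a * q ^ n) • (qad q a x₁ y₁ n * k₁ * x₂) := by
      rw [mul_assoc, (cz n).eq, ← mul_assoc, hkz, smul_mul_assoc]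
    rw [add_mul, mul_add, e, e', smul_add]
    simp only [qad]
    abel
  induction n with
  | zero => simp [qad, mixAux_zero_left]
  | succ n ih =>
    rw [qad, ih, mul_add, add_mul (qad q a x₁ y₁ n), smul_add, add_sub_add_comm, first, Finset.mul_sum,
      Finset.sum_mul, Finset.smul_sum, ← Finset.sum_sub_distrib]
    congr 1
    let m : ℕ → ℕ → T := fun p l => x₁ ^ p * k₁ ^ l * j₁ * qad q a x₂ y₂ l
    let g₁ : ℕ × ℕ → T := fun pl => match pl with
      | (0, _) => 0
      | (p + 1, l) => ((1 - a * b * q ^ (2 * l + p)) * mixAux q (a * b) p l) • m (p + 1) l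
    let g₂ : ℕ × ℕ → T := fun pl => match pl with
      | (_, 0) => 0
      | (p, l + 1) => (q ^ p * mixAux q (a * b) p l) • m p (l + 1)
    have hg : ∀ pl ∈ Finset.HasAntidiagonal.antidiagonal (n + 1),
        mixAux q (a * b) pl.1 pl.2 • m pl.1 pl.2 = g₁ pl + g₂ pl := by
      rintro ⟨p, l⟩ hpl
      rcases p with _ | p <;> rcases l with _ | l
      · simp at hpl
      · simp [g₁, g₂, mixAux_zero_left]
      · simp [g₁, g₂, mixAux_rec_zero]
      · simp only [g₁, g₂, mixAux_rec, add_smul]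
        rw [add_comm]
    refine Eq.trans ?_ (Finset.sum_congr rfl hg).symm
    rw [Finset.sum_add_distrib, Finset.Nat.sum_antidiagonal_succ, Finset.Nat.sum_antidiagonal_succ']
    have z₁ : g₁ (0, n + 1) = 0 := rfl
    have z₂ : g₂ (n + 1, 0) = 0 := rfl
    rw [z₁, z₂, zero_add, zero_add, ← Finset.sum_add_distrib]
    refine Finset.sum_congr rfl ?_
    rintro ⟨p, l⟩ hpl
    have hn : p + l = n := by simpa using hpl
    have hs := step p l
    rw [hn] at hs
    simp only [g₁, g₂, m, mul_smul_comm, smul_mul_assoc]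
    rw [smul_comm (a * q ^ n), ← smul_sub, hs, smul_add, smul_smul, smul_smul,
      mul_comm (mixAux q (a * b) p l), mul_comm (mixAux q (a * b) p l)]

/-- The adjoint action of a skew primitive element, iterated on a weight vector. -/
theorem iterate_eq_qad (q a : K) (x y k k' : T) (hk : k * k' = 1) (hkx : k * x = q • (x * k))
    (hky : k * y = a • (y * k)) (n : ℕ) :
    (fun z => x * z - k * z * k' * x)^[n] y = qad q a x y n := by
  have hkz : ∀ n, k * qad q a x y n = (a * q ^ n) • (qad q a x y n * k) := by
    intro n
    induction n with
    | zero => simpa [qad] using hky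
    | succ n ih =>
      simp only [qad, mul_sub, sub_mul, mul_smul_comm, smul_mul_assoc, smul_sub]
      have e1 : k * (x * qad q a x y n) = (a * q ^ (n + 1)) • (x * qad q a x y n * k) := by
        rw [← mul_assoc, hkx, smul_mul_assoc, mul_assoc, ih, mul_smul_comm, smul_smul, mul_assoc]
        congr 1; ring
      have e2 : k * (qad q a x y n * x) = (a * q ^ (n + 1)) • (qad q a x y n * x * k) := by
        rw [← mul_assoc, ih, smul_mul_assoc, mul_assoc, hkx, mul_smul_comm, smul_smul, ← mul_assoc]
        congr 1; ring
      rw [e1, e2, smul_smul, smul_smul]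
      congr 2; ring
  induction n with
  | zero => rfl
  | succ n ih =>
    rw [Function.iterate_succ_apply', ih, qad, hkz, smul_mul_assoc, smul_mul_assoc,
      mul_assoc (qad q a x y n), hk, mul_one]

theorem map_qad {T' : Type*} [Ring T'] [Algebra K T'] (φ : T →ₐ[K] T') (q a : K) (x y : T)
    (n : ℕ) : φ (qad q a x y n) = qad q a (φ x) (φ y) n := by
  induction n with
  | zero => rfl
  | succ n ih => simp [qad, ih]

/-- The quantum Serre elements of skew primitive elements are skew primitive. -/
theorem qad_skew_serre (q a b : K) (x₁ y₁ k₁ j₁ x₂ y₂ : T)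
    (hkx : k₁ * x₁ = q • (x₁ * k₁)) (hky : k₁ * y₁ = a • (y₁ * k₁)) (hjx : j₁ * x₁ = b • (x₁ * j₁))
    (hjk : j₁ * k₁ = k₁ * j₁)
    (cxx : Commute x₂ x₁) (cxy : Commute x₂ y₁) (cxk : Commute x₂ k₁) (cxj : Commute x₂ j₁)
    (cyx : Commute y₂ x₁) (cyk : Commute y₂ k₁) (n : ℕ) (hab : a * b * q ^ n = 1) :
    qad q a (x₁ + k₁ * x₂) (y₁ + j₁ * y₂) (n + 1) = qad q a x₁ y₁ (n + 1) +
      k₁ ^ (n + 1) * j₁ * qad q a x₂ y₂ (n + 1) := by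
  rw [qad_skew q a b x₁ y₁ k₁ j₁ x₂ y₂ hkx hky hjx hjk cxx cxy cxk cxj cyx cyk]
  congr 1
  rw [Finset.sum_eq_single (0, n + 1)]
  · simp [mixAux_zero_left]
  · rintro ⟨p, l⟩ hpl hne
    have hn : p + l = n + 1 := by simpa using hpl
    have hp : 1 ≤ p := by
      rcases p with _ | p
      · exact absurd (by simp; omega) hne
      · omega
    have hz : mixAux q (a * b) p l = 0 := by
      rw [mixAux, Finset.prod_eq_zero (i := p - 1) (by simp; omega), mul_zero]
      rw [show l + (p - 1) = n by omega, hab, sub_self]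
    simp [hz]
  · intro h
    exact absurd (by simp) h

end Skew

/-! ### The two-parameter quantum group -/

/-- The generators `e i`, `f i`, `ω i`, `(ω i)⁻¹`, `ω' i`, `(ω' i)⁻¹`. -/
inductive Gen (n : ℕ) : Type
  | e (i : Fin n)
  | f (i : Fin n)
  | om (i : Fin n)
  | omInv (i : Fin n)
  | omP (i : Fin n)
  | omPInv (i : Fin n)

/-- The generators `ω i`, `ω' i` and their inverses. -/
def Gen.IsToral {n : ℕ} : Gen n → Prop
  | .e _ => False
  | .f _ => False
  | _ => True

/-- A generator as an element of the free algebra. -/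
abbrev gen (K : Type*) [Field K] {n : ℕ} (x : Gen n) : FreeAlgebra K (Gen n) := FreeAlgebra.ι K x

/-- The left adjoint action `y ↦ e i * y + ω i * y * S (e i)` with `S (e i) = -(ω i)⁻¹ * e i`. -/
def adE (K : Type*) [Field K] {n : ℕ} (i : Fin n) (y : FreeAlgebra K (Gen n)) :
    FreeAlgebra K (Gen n) :=
  gen K (.e i) * y - gen K (.om i) * y * gen K (.omInv i) * gen K (.e i)

/-- The right adjoint action `y ↦ y * f i + S (f i) * y * ω' i` with `S (f i) = -f i * (ω' i)⁻¹`. -/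
def adF (K : Type*) [Field K] {n : ℕ} (i : Fin n) (y : FreeAlgebra K (Gen n)) :
    FreeAlgebra K (Gen n) :=
  y * gen K (.f i) - gen K (.f i) * gen K (.omPInv i) * y * gen K (.omP i)

theorem conj_aux {K A : Type*} [Field K] [Ring A] [Algebra K A] {k k' x : A} {c : K} (h : k * x * k' = c • x)
    (hk : k' * k = 1) : k * x = c • (x * k) := by
  rw [← smul_mul_assoc, ← h, mul_assoc, hk, mul_one]

theorem map_adE_iterate {K : Type*} [Field K] {m : ℕ} {A : Type*} [Ring A] [Algebra K A] (φ : FreeAlgebra K (Gen m) →ₐ[K] A)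
    (i j : Fin m) (n : ℕ) : φ ((adE K i)^[n] (gen K (.e j))) =
      (fun z => φ (gen K (.e i)) * z - φ (gen K (.om i)) * z * φ (gen K (.omInv i)) *
        φ (gen K (.e i)))^[n] (φ (gen K (.e j))) := by
  refine Function.Semiconj.iterate_right (f := φ) ?_ n _
  intro y
  simp [adE]

theorem map_adF_iterate {K : Type*} [Field K] {m : ℕ} {A : Type*} [Ring A] [Algebra K A] (φ : FreeAlgebra K (Gen m) →ₐ[K] A)
    (i j : Fin m) (n : ℕ) :
    MulOpposite.op (φ ((adF K i)^[n] (gen K (.f j)))) =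
      (fun z => MulOpposite.op (φ (gen K (.f i))) * z - MulOpposite.op (φ (gen K (.omP i))) * z *
        MulOpposite.op (φ (gen K (.omPInv i))) * MulOpposite.op (φ (gen K (.f i))))^[n]
        (MulOpposite.op (φ (gen K (.f j)))) := by
  refine Function.Semiconj.iterate_right (f := fun y => MulOpposite.op (φ y)) ?_ n _
  intro y
  simp [adF, mul_assoc]

section Presentation

variable {X : DynkinType} {K : Type*} [Field K] [CharZero K] (P : Parameters X K)

/-- The defining relations. -/
inductive Rel : FreeAlgebra K (Gen X.rank) → FreeAlgebra K (Gen X.rank) → Prop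
  | toral_comm (x y : Gen X.rank) (hx : x.IsToral) (hy : y.IsToral) :
      Rel (gen K x * gen K y) (gen K y * gen K x)
  | om_inv (i : Fin X.rank) : Rel (gen K (.om i) * gen K (.omInv i)) 1
  | omP_inv (i : Fin X.rank) : Rel (gen K (.omP i) * gen K (.omPInv i)) 1
  | om_e (i j : Fin X.rank) :
      Rel (gen K (.om i) * gen K (.e j) * gen K (.omInv i)) (P.a i j • gen K (.e j))
  | om_f (i j : Fin X.rank) :
      Rel (gen K (.om i) * gen K (.f j) * gen K (.omInv i)) ((P.a i j)⁻¹ • gen K (.f j))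
  | omP_e (i j : Fin X.rank) :
      Rel (gen K (.omP i) * gen K (.e j) * gen K (.omPInv i)) ((P.a j i)⁻¹ • gen K (.e j))
  | omP_f (i j : Fin X.rank) :
      Rel (gen K (.omP i) * gen K (.f j) * gen K (.omPInv i)) (P.a j i • gen K (.f j))
  | e_f_self (i : Fin X.rank) :
      Rel (gen K (.e i) * gen K (.f i) - gen K (.f i) * gen K (.e i))
        ((P.r ^ X.d i - P.s ^ X.d i)⁻¹ • (gen K (.om i) - gen K (.omP i)))
  | e_f (i j : Fin X.rank) (hij : i ≠ j) :
      Rel (gen K (.e i) * gen K (.f j) - gen K (.f j) * gen K (.e i)) 0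
  | serre_e (i j : Fin X.rank) (hij : i ≠ j) :
      Rel ((adE K i)^[(1 - X.cartan i j).toNat] (gen K (.e j))) 0
  | serre_f (i j : Fin X.rank) (hij : i ≠ j) :
      Rel ((adF K i)^[(1 - X.cartan i j).toNat] (gen K (.f j))) 0

/-- The two-parameter quantum group `U = U_{r,s}(𝔤)`. -/
abbrev QuantumGroup : Type _ := RingQuot (Rel P)

/-- The generators as elements of `U`. -/
def ug (x : Gen X.rank) : QuantumGroup P := RingQuot.mkAlgHom K (Rel P) (gen K x)

theorem ug_comm (x y : Gen X.rank) (hx : x.IsToral) (hy : y.IsToral) :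
    ug P x * ug P y = ug P y * ug P x := by
  simpa [ug] using RingQuot.mkAlgHom_rel K (Rel.toral_comm (P := P) x y hx hy)

theorem om_mul_inv (i : Fin X.rank) : ug P (.om i) * ug P (.omInv i) = 1 := by
  simpa [ug] using RingQuot.mkAlgHom_rel K (Rel.om_inv (P := P) i)

theorem omP_mul_inv (i : Fin X.rank) : ug P (.omP i) * ug P (.omPInv i) = 1 := by
  simpa [ug] using RingQuot.mkAlgHom_rel K (Rel.omP_inv (P := P) i)

theorem om_inv_mul (i : Fin X.rank) : ug P (.omInv i) * ug P (.om i) = 1 := by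
  rw [ug_comm P (.omInv i) (.om i) trivial trivial, om_mul_inv]

theorem omP_inv_mul (i : Fin X.rank) : ug P (.omPInv i) * ug P (.omP i) = 1 := by
  rw [ug_comm P (.omPInv i) (.omP i) trivial trivial, omP_mul_inv]

theorem om_e (i j : Fin X.rank) :
    ug P (.om i) * ug P (.e j) = P.a i j • (ug P (.e j) * ug P (.om i)) := by
  refine conj_aux (k' := ug P (.omInv i)) ?_ (om_inv_mul P i)
  simpa [ug] using RingQuot.mkAlgHom_rel K (Rel.om_e (P := P) i j)

theorem om_f (i j : Fin X.rank) :
    ug P (.om i) * ug P (.f j) = (P.a i j)⁻¹ • (ug P (.f j) * ug P (.om i)) := by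
  refine conj_aux (k' := ug P (.omInv i)) ?_ (om_inv_mul P i)
  simpa [ug] using RingQuot.mkAlgHom_rel K (Rel.om_f (P := P) i j)

theorem omP_e (i j : Fin X.rank) :
    ug P (.omP i) * ug P (.e j) = (P.a j i)⁻¹ • (ug P (.e j) * ug P (.omP i)) := by
  refine conj_aux (k' := ug P (.omPInv i)) ?_ (omP_inv_mul P i)
  simpa [ug] using RingQuot.mkAlgHom_rel K (Rel.omP_e (P := P) i j)

theorem omP_f (i j : Fin X.rank) :
    ug P (.omP i) * ug P (.f j) = P.a j i • (ug P (.f j) * ug P (.omP i)) := by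
  refine conj_aux (k' := ug P (.omPInv i)) ?_ (omP_inv_mul P i)
  simpa [ug] using RingQuot.mkAlgHom_rel K (Rel.omP_f (P := P) i j)

theorem e_f_self (i : Fin X.rank) : ug P (.e i) * ug P (.f i) - ug P (.f i) * ug P (.e i) =
    (P.r ^ X.d i - P.s ^ X.d i)⁻¹ • (ug P (.om i) - ug P (.omP i)) := by
  simpa [ug] using RingQuot.mkAlgHom_rel K (Rel.e_f_self (P := P) i)

theorem e_f (i j : Fin X.rank) (hij : i ≠ j) :
    ug P (.e i) * ug P (.f j) - ug P (.f j) * ug P (.e i) = 0 := by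
  simpa [ug] using RingQuot.mkAlgHom_rel K (Rel.e_f (P := P) i j hij)

theorem qad_e (i j : Fin X.rank) (hij : i ≠ j) : qad (P.a i i) (P.a i j) (ug P (.e i)) (ug P (.e j))
    (1 - X.cartan i j).toNat = 0 := by
  have h := RingQuot.mkAlgHom_rel K (Rel.serre_e (P := P) i j hij)
  rw [map_adE_iterate, map_zero] at h
  rw [← h, ← iterate_eq_qad (P.a i i) (P.a i j) _ _ (ug P (.om i)) (ug P (.omInv i))
    (om_mul_inv P i) (om_e P i i) (om_e P i j)]
  rfl

theorem qad_f (i j : Fin X.rank) (hij : i ≠ j) : qad (P.a i i)⁻¹ (P.a j i)⁻¹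
    (MulOpposite.op (ug P (.f i))) (MulOpposite.op (ug P (.f j)))
    (1 - X.cartan i j).toNat = 0 := by
  have h := congrArg MulOpposite.op (RingQuot.mkAlgHom_rel K (Rel.serre_f (P := P) i j hij))
  rw [map_adF_iterate, map_zero, MulOpposite.op_zero] at h
  rw [← h, ← iterate_eq_qad (P.a i i)⁻¹ (P.a j i)⁻¹ _ _ (MulOpposite.op (ug P (.omP i)))
    (MulOpposite.op (ug P (.omPInv i)))]
  · rfl
  · rw [← MulOpposite.op_mul, omP_inv_mul, MulOpposite.op_one]
  · rw [← MulOpposite.op_mul, ← MulOpposite.op_mul, omP_f, MulOpposite.op_smul, smul_smul,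
      inv_mul_cancel₀ (P.a_ne_zero i i), one_smul]
  · rw [← MulOpposite.op_mul, ← MulOpposite.op_mul, omP_f, MulOpposite.op_smul, smul_smul,
      inv_mul_cancel₀ (P.a_ne_zero j i), one_smul]

/-- The values of the comultiplication on the generators. -/
def comulGen : Gen X.rank → QuantumGroup P ⊗[K] QuantumGroup P
  | .e i => ug P (.e i) ⊗ₜ 1 + ug P (.om i) ⊗ₜ ug P (.e i)
  | .f i => 1 ⊗ₜ ug P (.f i) + ug P (.f i) ⊗ₜ ug P (.omP i)
  | .om i => ug P (.om i) ⊗ₜ ug P (.om i)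
  | .omInv i => ug P (.omInv i) ⊗ₜ ug P (.omInv i)
  | .omP i => ug P (.omP i) ⊗ₜ ug P (.omP i)
  | .omPInv i => ug P (.omPInv i) ⊗ₜ ug P (.omPInv i)

/-- The comultiplication on the free algebra. -/
def comulFree : FreeAlgebra K (Gen X.rank) →ₐ[K] QuantumGroup P ⊗[K] QuantumGroup P :=
  FreeAlgebra.lift K (comulGen P)

theorem comulFree_gen (x : Gen X.rank) : comulFree P (gen K x) = comulGen P x := by
  simp [comulFree, gen]

theorem comulGen_om_e (i j : Fin X.rank) : comulGen P (.om i) * comulGen P (.e j) =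
    P.a i j • (comulGen P (.e j) * comulGen P (.om i)) := by
  simp only [comulGen, mul_add, add_mul, Algebra.TensorProduct.tmul_mul_tmul, om_e, one_mul,
    mul_one, TensorProduct.tmul_smul, ← TensorProduct.smul_tmul', smul_add,
    ug_comm P (.om i) (.om j) trivial trivial]

theorem comulGen_om_f (i j : Fin X.rank) : comulGen P (.om i) * comulGen P (.f j) =
    (P.a i j)⁻¹ • (comulGen P (.f j) * comulGen P (.om i)) := by
  simp only [comulGen, mul_add, add_mul, Algebra.TensorProduct.tmul_mul_tmul, om_f, one_mul,
    mul_one, TensorProduct.tmul_smul, ← TensorProduct.smul_tmul', smul_add,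
    ug_comm P (.om i) (.omP j) trivial trivial]

theorem comulGen_omP_e (i j : Fin X.rank) : comulGen P (.omP i) * comulGen P (.e j) =
    (P.a j i)⁻¹ • (comulGen P (.e j) * comulGen P (.omP i)) := by
  simp only [comulGen, mul_add, add_mul, Algebra.TensorProduct.tmul_mul_tmul, omP_e, one_mul,
    mul_one, TensorProduct.tmul_smul, ← TensorProduct.smul_tmul', smul_add,
    ug_comm P (.omP i) (.om j) trivial trivial]

theorem comulGen_omP_f (i j : Fin X.rank) : comulGen P (.omP i) * comulGen P (.f j) =
    P.a j i • (comulGen P (.f j) * comulGen P (.omP i)) := by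
  simp only [comulGen, mul_add, add_mul, Algebra.TensorProduct.tmul_mul_tmul, omP_f, one_mul,
    mul_one, TensorProduct.tmul_smul, ← TensorProduct.smul_tmul', smul_add,
    ug_comm P (.omP i) (.omP j) trivial trivial]

theorem comulGen_om_inv (i : Fin X.rank) : comulGen P (.om i) * comulGen P (.omInv i) = 1 := by
  simp [comulGen, om_mul_inv, Algebra.TensorProduct.one_def]

theorem comulGen_omP_inv (i : Fin X.rank) : comulGen P (.omP i) * comulGen P (.omPInv i) = 1 := by
  simp [comulGen, omP_mul_inv, Algebra.TensorProduct.one_def]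

theorem comulGen_omP_inv' (i : Fin X.rank) : comulGen P (.omPInv i) * comulGen P (.omP i) = 1 := by
  simp [comulGen, omP_inv_mul, Algebra.TensorProduct.one_def]

theorem comulGen_serre_e (i j : Fin X.rank) (hij : i ≠ j) :
    comulFree P ((adE K i)^[(1 - X.cartan i j).toNat] (gen K (.e j))) = 0 := by
  refine (map_adE_iterate (K := K) (A := QuantumGroup P ⊗[K] QuantumGroup P) (comulFree P) i j _).trans ?_
  simp only [comulFree_gen]
  rw [iterate_eq_qad (P.a i i) (P.a i j) _ _ _ _ (comulGen_om_inv P i) (comulGen_om_e P i i)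
    (comulGen_om_e P i j)]
  have hN : (1 - X.cartan i j).toNat = (-X.cartan i j).toNat + 1 := by
    have := X.cartan_nonpos hij; omega
  let L : QuantumGroup P →ₐ[K] QuantumGroup P ⊗[K] QuantumGroup P :=
    Algebra.TensorProduct.includeLeft
  let R : QuantumGroup P →ₐ[K] QuantumGroup P ⊗[K] QuantumGroup P :=
    Algebra.TensorProduct.includeRight
  have hc : ∀ x y, Commute (R x) (L y) := fun x y => by
    simp [L, R, Commute, SemiconjBy, Algebra.TensorProduct.tmul_mul_tmul]
  have h1 : ∀ k, comulGen P (.e k) = L (ug P (.e k)) + L (ug P (.om k)) * R (ug P (.e k)) := by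
    intro k
    simp [L, R, comulGen, Algebra.TensorProduct.tmul_mul_tmul]
  have hz := qad_e P i j hij
  rw [hN] at hz ⊢
  rw [h1, h1, qad_skew_serre (P.a i i) (P.a i j) (P.a j i)]
  · rw [← map_qad, ← map_qad, hz, map_zero, map_zero, mul_zero, add_zero]
  · rw [← map_mul, ← map_mul, om_e, map_smul]
  · rw [← map_mul, ← map_mul, om_e, map_smul]
  · rw [← map_mul, ← map_mul, om_e, map_smul]
  · rw [← map_mul, ← map_mul, ug_comm P (.om j) (.om i) trivial trivial]
  · exact hc _ _
  · exact hc _ _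
  · exact hc _ _
  · exact hc _ _
  · exact hc _ _
  · exact hc _ _
  · exact P.a_mul_a i j hij

theorem comulGen_serre_f (i j : Fin X.rank) (hij : i ≠ j) :
    comulFree P ((adF K i)^[(1 - X.cartan i j).toNat] (gen K (.f j))) = 0 := by
  apply MulOpposite.op_injective
  refine (map_adF_iterate (K := K) (A := QuantumGroup P ⊗[K] QuantumGroup P) (comulFree P) i j _).trans ?_
  rw [MulOpposite.op_zero]
  simp only [comulFree_gen]
  have hq : ∀ k, MulOpposite.op (comulGen P (.omP i)) * MulOpposite.op (comulGen P (.f k)) =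
      (P.a k i)⁻¹ • (MulOpposite.op (comulGen P (.f k)) * MulOpposite.op (comulGen P (.omP i))) := by
    intro k
    rw [← MulOpposite.op_mul, ← MulOpposite.op_mul, comulGen_omP_f, MulOpposite.op_smul, smul_smul,
      inv_mul_cancel₀ (P.a_ne_zero k i), one_smul]
  have hk : MulOpposite.op (comulGen P (.omP i)) * MulOpposite.op (comulGen P (.omPInv i)) = 1 := by
    rw [← MulOpposite.op_mul, comulGen_omP_inv', MulOpposite.op_one]
  refine (iterate_eq_qad (K := K) (T := (QuantumGroup P ⊗[K] QuantumGroup P)ᵐᵒᵖ)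
    (P.a i i)⁻¹ (P.a j i)⁻¹ _ _ _ _ hk (hq i) (hq j) _).trans ?_
  have hN : (1 - X.cartan i j).toNat = (-X.cartan i j).toNat + 1 := by
    have := X.cartan_nonpos hij; omega
  let L : (QuantumGroup P)ᵐᵒᵖ →ₐ[K] (QuantumGroup P ⊗[K] QuantumGroup P)ᵐᵒᵖ :=
    AlgHom.op Algebra.TensorProduct.includeRight
  let R : (QuantumGroup P)ᵐᵒᵖ →ₐ[K] (QuantumGroup P ⊗[K] QuantumGroup P)ᵐᵒᵖ :=
    AlgHom.op Algebra.TensorProduct.includeLeft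
  have hL : ∀ x, L (MulOpposite.op x) = MulOpposite.op (1 ⊗ₜ x) := fun x => rfl
  have hR : ∀ x, R (MulOpposite.op x) = MulOpposite.op (x ⊗ₜ 1) := fun x => rfl
  have hc : ∀ x y, Commute (R (MulOpposite.op x)) (L (MulOpposite.op y)) := fun x y => by
    rw [hL, hR, Commute, SemiconjBy, ← MulOpposite.op_mul, ← MulOpposite.op_mul]
    simp [Algebra.TensorProduct.tmul_mul_tmul]
  have h1 : ∀ k, MulOpposite.op (comulGen P (.f k)) = L (MulOpposite.op (ug P (.f k))) +
      L (MulOpposite.op (ug P (.omP k))) * R (MulOpposite.op (ug P (.f k))) := by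
    intro k
    rw [hL, hR, hL, ← MulOpposite.op_mul, ← MulOpposite.op_add]
    simp [comulGen, Algebra.TensorProduct.tmul_mul_tmul]
  have hf : ∀ i k, MulOpposite.op (ug P (.omP i)) * MulOpposite.op (ug P (.f k)) =
      (P.a k i)⁻¹ • (MulOpposite.op (ug P (.f k)) * MulOpposite.op (ug P (.omP i))) := by
    intro i k
    rw [← MulOpposite.op_mul, ← MulOpposite.op_mul, omP_f, MulOpposite.op_smul, smul_smul,
      inv_mul_cancel₀ (P.a_ne_zero k i), one_smul]
  have hz := qad_f P i j hij
  rw [hN] at hz ⊢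
  rw [h1, h1, qad_skew_serre (P.a i i)⁻¹ (P.a j i)⁻¹ (P.a i j)⁻¹]
  · rw [← map_qad, ← map_qad, hz, map_zero, map_zero, mul_zero, add_zero]
  · rw [← map_mul, ← map_mul, hf, map_smul]
  · rw [← map_mul, ← map_mul, hf, map_smul]
  · rw [← map_mul, ← map_mul, hf, map_smul]
  · rw [← map_mul, ← map_mul, ← MulOpposite.op_mul,
      ug_comm P (.omP i) (.omP j) trivial trivial, MulOpposite.op_mul]
  · exact hc _ _
  · exact hc _ _
  · exact hc _ _
  · exact hc _ _
  · exact hc _ _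
  · exact hc _ _
  · have h := P.a_mul_a i j hij
    rw [inv_pow, ← mul_inv, ← mul_inv, mul_comm (P.a j i), h, inv_one]

theorem comulGen_e_f (i j : Fin X.rank) :
    comulGen P (.e i) * comulGen P (.f j) - comulGen P (.f j) * comulGen P (.e i) =
      (ug P (.e i) * ug P (.f j) - ug P (.f j) * ug P (.e i)) ⊗ₜ ug P (.omP j) +
        ug P (.om i) ⊗ₜ (ug P (.e i) * ug P (.f j) - ug P (.f j) * ug P (.e i)) := by
  simp only [comulGen, mul_add, add_mul, Algebra.TensorProduct.tmul_mul_tmul, one_mul, mul_one,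
    om_f, omP_e, TensorProduct.tmul_smul, ← TensorProduct.smul_tmul', TensorProduct.sub_tmul,
    TensorProduct.tmul_sub]
  abel

theorem comulFree_rel ⦃x y : FreeAlgebra K (Gen X.rank)⦄ (h : Rel P x y) :
    comulFree P x = comulFree P y := by
  have conj : ∀ {k x k' : QuantumGroup P ⊗[K] QuantumGroup P} {c : K}, k * x = c • (x * k) →
      k * k' = 1 → k * x * k' = c • x := by
    intro k x k' c h hk
    rw [h, smul_mul_assoc, mul_assoc, hk, mul_one]
  cases h with
  | toral_comm x y hx hy =>
    simp only [map_mul, comulFree_gen]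
    have h := ug_comm P x y hx hy
    cases x <;> cases y <;> first | exact hx.elim | exact hy.elim | skip
    all_goals
      simp only [comulGen, Algebra.TensorProduct.tmul_mul_tmul, h]
  | om_inv i => simp only [map_mul, comulFree_gen, comulGen_om_inv, map_one]
  | omP_inv i => simp only [map_mul, comulFree_gen, comulGen_omP_inv, map_one]
  | om_e i j =>
    simp only [map_mul, map_smul, comulFree_gen]
    exact conj (comulGen_om_e P i j) (comulGen_om_inv P i)
  | om_f i j =>
    simp only [map_mul, map_smul, comulFree_gen]
    exact conj (comulGen_om_f P i j) (comulGen_om_inv P i)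
  | omP_e i j =>
    simp only [map_mul, map_smul, comulFree_gen]
    exact conj (comulGen_omP_e P i j) (comulGen_omP_inv P i)
  | omP_f i j =>
    simp only [map_mul, map_smul, comulFree_gen]
    exact conj (comulGen_omP_f P i j) (comulGen_omP_inv P i)
  | e_f_self i =>
    simp only [map_sub, map_mul, map_smul, comulFree_gen]
    rw [comulGen_e_f, e_f_self]
    simp only [comulGen, TensorProduct.tmul_smul, ← TensorProduct.smul_tmul',
      TensorProduct.sub_tmul, TensorProduct.tmul_sub]
    rw [← smul_add]
    congr 1
    abel
  | e_f i j hij =>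
    simp only [map_sub, map_mul, map_zero, comulFree_gen]
    rw [comulGen_e_f, e_f P i j hij, TensorProduct.zero_tmul, TensorProduct.tmul_zero, add_zero]
  | serre_e i j hij => rw [comulGen_serre_e P i j hij, map_zero]
  | serre_f i j hij => rw [comulGen_serre_f P i j hij, map_zero]

/-- The comultiplication of `U`. -/
def comul : QuantumGroup P →ₐ[K] QuantumGroup P ⊗[K] QuantumGroup P :=
  RingQuot.liftAlgHom K ⟨comulFree P, comulFree_rel P⟩

theorem comul_ug (x : Gen X.rank) : comul P (ug P x) = comulGen P x := by
  rw [comul, ug, RingQuot.liftAlgHom_mkAlgHom_apply, comulFree_gen]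

end Presentation

/-! ### Weights -/

namespace Parameters

variable {X : DynkinType} {K : Type*} [Field K] [CharZero K] (P : Parameters X K)

theorem zpow_eq_one {a b : ℤ} (h : P.r ^ a * P.s ^ b = 1) : a = 0 ∧ b = 0 := by
  have h1 : P.r ^ a.toNat * P.s ^ b.toNat = P.r ^ (-a).toNat * P.s ^ (-b).toNat := by
    simp only [← zpow_natCast]
    have ha : (a.toNat : ℤ) = a + ((-a).toNat : ℤ) := by omega
    have hb : (b.toNat : ℤ) = b + ((-b).toNat : ℤ) := by omega
    rw [ha, hb, zpow_add₀ P.r_ne_zero, zpow_add₀ P.s_ne_zero, mul_mul_mul_comm, h, one_mul]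
  have h2 := P.algebraicIndependent (a₁ := MvPolynomial.X 0 ^ a.toNat * MvPolynomial.X 1 ^ b.toNat)
    (a₂ := MvPolynomial.X 0 ^ (-a).toNat * MvPolynomial.X 1 ^ (-b).toNat) (by simpa using h1)
  simp only [MvPolynomial.X_pow_eq_monomial, MvPolynomial.monomial_mul, one_mul] at h2
  have h3 := MvPolynomial.monomial_left_injective (one_ne_zero (α := ℚ)) h2
  have h4 := DFunLike.congr_fun h3 0
  have h5 := DFunLike.congr_fun h3 1
  simp at h4 h5
  omega

theorem rRoot_ne_zero : P.rRoot ≠ 0 := by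
  intro h
  have h1 := P.rRoot_pow
  rw [h, zero_pow (pow_ne_zero 2 X.latticeIndex_spec.1.ne')] at h1
  exact P.r_ne_zero h1.symm

theorem sRoot_ne_zero : P.sRoot ≠ 0 := by
  intro h
  have h1 := P.sRoot_pow
  rw [h, zero_pow (pow_ne_zero 2 X.latticeIndex_spec.1.ne')] at h1
  exact P.s_ne_zero h1.symm

theorem root_zpow_eq_one {a b : ℤ} (h : P.rRoot ^ a * P.sRoot ^ b = 1) : a = 0 ∧ b = 0 := by
  apply P.zpow_eq_one
  have h1 := congrArg (fun x => x ^ (X.latticeIndex ^ 2)) h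
  simp only [mul_pow, one_pow] at h1
  rw [← P.rRoot_pow, ← P.sRoot_pow]
  rw [← h1]
  simp only [← zpow_natCast, ← zpow_mul, mul_comm]

theorem aRoot_ne_zero (i j : Fin X.rank) : P.aRoot i j ≠ 0 :=
  mul_ne_zero (zpow_ne_zero _ P.rRoot_ne_zero) (zpow_ne_zero _ P.sRoot_ne_zero)

theorem aRoot_pow (i j : Fin X.rank) : P.aRoot i j ^ (X.latticeIndex ^ 2) = P.a i j := by
  rw [aRoot, a, mul_pow, ← P.rRoot_pow, ← P.sRoot_pow]
  simp only [← zpow_natCast, ← zpow_mul, mul_comm]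

/-- The character `ϱ^η` on `ω j`, that is `∏ i, (a j i) ^ (η i)` where `η = ∑ i, η i • α i`. -/
def weightOm (η : X.Weight) (j : Fin X.rank) : K :=
  ∏ i, fracPow X (P.aRoot j i) (X.simpleCoord η i)

/-- The character `ϱ^η` on `ω' j`, that is `∏ i, (a i j) ^ (-η i)` where `η = ∑ i, η i • α i`. -/
def weightOmP (η : X.Weight) (j : Fin X.rank) : K :=
  ∏ i, fracPow X (P.aRoot i j) (-X.simpleCoord η i)

/-- The scalar `(r s⁻¹) ^ (-(2 / ℓ) (ρ, η))`. -/
def thetaScalar (η : X.Weight) : K :=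
  fracPow X (P.rRoot * P.sRoot⁻¹)
    (-(2 / X.ell) * X.form (X.simpleCoord X.rho) (X.simpleCoord η))

end Parameters

theorem DynkinType.exists_coord (X : DynkinType) (η : X.Weight) : ∃ z : Fin X.rank → ℤ, ∀ i,
    X.simpleCoord η i * (X.latticeIndex : ℚ) ^ 2 = z i := by
  choose z hz using fun i => X.latticeIndex_spec.2 η i
  refine ⟨fun i => z i * X.latticeIndex, fun i => ?_⟩
  push_cast
  rw [← hz]
  ring

theorem zpow_sum_aux {K ι : Type*} [Field K] {b : K} (hb : b ≠ 0) (s : Finset ι) (f : ι → ℤ) :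
    b ^ (∑ i ∈ s, f i) = ∏ i ∈ s, b ^ f i := by
  classical
  induction s using Finset.induction_on with
  | empty => simp
  | insert i s hi ih => rw [Finset.sum_insert hi, Finset.prod_insert hi, zpow_add₀ hb, ih]

theorem fracPow_eq (X : DynkinType) {K : Type*} [Field K] (b : K) {x : ℚ} {z : ℤ}
    (h : x * (X.latticeIndex : ℚ) ^ 2 = z) : fracPow X b x = b ^ z := by
  rw [fracPow, h, Int.floor_intCast]

theorem fracPow_coord_add (X : DynkinType) {K : Type*} [Field K] {b : K} (hb : b ≠ 0)
    (η μ : X.Weight) (i : Fin X.rank) : fracPow X b (X.simpleCoord (η + μ) i) =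
      fracPow X b (X.simpleCoord η i) * fracPow X b (X.simpleCoord μ i) := by
  obtain ⟨z, hz⟩ := X.exists_coord η
  obtain ⟨w, hw⟩ := X.exists_coord μ
  have h : X.simpleCoord (η + μ) i * (X.latticeIndex : ℚ) ^ 2 = ((z i + w i : ℤ) : ℚ) := by
    rw [X.simpleCoord_add, Pi.add_apply, add_mul, hz, hw]; push_cast; ring
  rw [fracPow_eq X b h, fracPow_eq X b (hz i), fracPow_eq X b (hw i), zpow_add₀ hb]

theorem fracPow_neg_coord (X : DynkinType) {K : Type*} [Field K] (b : K)
    (η : X.Weight) (i : Fin X.rank) : fracPow X b (-X.simpleCoord η i) =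
      (fracPow X b (X.simpleCoord η i))⁻¹ := by
  obtain ⟨z, hz⟩ := X.exists_coord η
  have h : -X.simpleCoord η i * (X.latticeIndex : ℚ) ^ 2 = ((-z i : ℤ) : ℚ) := by
    rw [neg_mul, hz]; push_cast; ring
  rw [fracPow_eq X b h, fracPow_eq X b (hz i), zpow_neg]

theorem fracPow_simpleRoot (X : DynkinType) {K : Type*} [Field K] (b : K) (i k : Fin X.rank) :
    fracPow X b (X.simpleCoord (X.simpleRoot i) k) =
      if k = i then b ^ (X.latticeIndex ^ 2) else 1 := by
  rw [X.simpleCoord_simpleRoot]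
  split_ifs with h
  · rw [fracPow_eq X b (z := ((X.latticeIndex ^ 2 : ℕ) : ℤ)) (by push_cast; ring), zpow_natCast]
  · rw [fracPow_eq X b (z := 0) (by simp), zpow_zero]

namespace Parameters

variable {X : DynkinType} {K : Type*} [Field K] [CharZero K] (P : Parameters X K)

theorem weightOm_add (η μ : X.Weight) (j : Fin X.rank) :
    P.weightOm (η + μ) j = P.weightOm η j * P.weightOm μ j := by
  simp only [weightOm, ← Finset.prod_mul_distrib]
  exact Finset.prod_congr rfl fun i _ => fracPow_coord_add X (P.aRoot_ne_zero j i) η μ i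

theorem weightOmP_add (η μ : X.Weight) (j : Fin X.rank) :
    P.weightOmP (η + μ) j = P.weightOmP η j * P.weightOmP μ j := by
  simp only [weightOmP, ← Finset.prod_mul_distrib]
  refine Finset.prod_congr rfl fun i _ => ?_
  simp only [fracPow_neg_coord]
  rw [fracPow_coord_add X (P.aRoot_ne_zero i j) η μ i, mul_inv]

theorem weightOm_simpleRoot (i j : Fin X.rank) : P.weightOm (X.simpleRoot i) j = P.a j i := by
  simp only [weightOm, fracPow_simpleRoot]
  rw [Finset.prod_ite_eq' Finset.univ i (fun k => P.aRoot j k ^ X.latticeIndex ^ 2)]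
  simp [aRoot_pow]

theorem weightOmP_simpleRoot (i j : Fin X.rank) :
    P.weightOmP (X.simpleRoot i) j = (P.a i j)⁻¹ := by
  simp only [weightOmP, fracPow_neg_coord, Finset.prod_inv_distrib, fracPow_simpleRoot]
  rw [Finset.prod_ite_eq' Finset.univ i (fun k => P.aRoot k j ^ X.latticeIndex ^ 2)]
  simp [aRoot_pow]

theorem weightOm_ne_zero (η : X.Weight) (j : Fin X.rank) : P.weightOm η j ≠ 0 :=
  Finset.prod_ne_zero_iff.mpr fun i _ => zpow_ne_zero _ (P.aRoot_ne_zero j i)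

theorem weightOm_injective : Function.Injective P.weightOm := by
  intro η μ h
  obtain ⟨ν, rfl⟩ : ∃ ν, η = ν + μ := ⟨η - μ, by abel⟩
  have h1 : ∀ j, P.weightOm ν j = 1 := by
    intro j
    have h2 := congrFun h j
    rw [weightOm_add] at h2
    exact mul_right_cancel₀ (P.weightOm_ne_zero μ j) (h2.trans (one_mul _).symm)
  obtain ⟨z, hz⟩ := X.exists_coord ν
  have h3 : ∀ j, ∑ i, X.cartan j i * z i = 0 := by
    intro j
    have h4 := h1 j
    have h5 : P.weightOm ν j = P.rRoot ^ (∑ i, X.euler i j * z i) *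
        P.sRoot ^ (∑ i, -X.euler j i * z i) := by
      rw [zpow_sum_aux P.rRoot_ne_zero, zpow_sum_aux P.sRoot_ne_zero, ← Finset.prod_mul_distrib]
      refine Finset.prod_congr rfl fun i _ => ?_
      rw [fracPow_eq X _ (hz i), aRoot, mul_zpow, ← zpow_mul, ← zpow_mul]
    obtain ⟨e1, e2⟩ := P.root_zpow_eq_one (h5.symm.trans h4)
    have e3 : X.d j * ∑ i, X.cartan j i * z i = 0 := by
      have e4 : ∑ i, X.euler i j * z i - ∑ i, -X.euler j i * z i = 0 := by rw [e1, e2, sub_zero]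
      rw [← Finset.sum_sub_distrib] at e4
      rw [Finset.mul_sum, ← e4]
      refine Finset.sum_congr rfl fun i _ => ?_
      have := X.euler_add j i
      linear_combination -z i * this
    exact (mul_eq_zero.mp e3).resolve_left (X.d_pos j).ne'
  have h6 : ν = 0 := by
    funext j
    have h7 := X.cartan_simpleCoord ν j
    have h8 : (ν j : ℚ) * (X.latticeIndex : ℚ) ^ 2 = 0 := by
      rw [← h7, Finset.sum_mul]
      have h9 : ((∑ i, X.cartan j i * z i : ℤ) : ℚ) = 0 := by rw [h3 j]; simp
      rw [← h9]
      push_cast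
      exact Finset.sum_congr rfl fun i _ => by rw [mul_assoc, hz]
    have hm : (X.latticeIndex : ℚ) ^ 2 ≠ 0 :=
      pow_ne_zero 2 (Nat.cast_ne_zero.mpr X.latticeIndex_spec.1.ne')
    exact_mod_cast (mul_eq_zero.mp h8).resolve_right hm
  rw [h6, zero_add]

end Parameters

/-! ### Highest weight modules -/

section Generic

variable {K V : Type*} [Field K] [AddCommGroup V] [Module K V]

theorem eigen_iSupIndep {κ ι : Type*} (f : κ → Module.End K V) (hf : ∀ i j, Commute (f i) (f j))
    (χ : ι → κ → K) (hχ : Function.Injective χ) (W : ι → Submodule K V)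
    (hW : ∀ μ i, W μ ≤ (f i).eigenspace (χ μ i)) : iSupIndep W := by
  have h := Module.End.independent_iInf_maxGenEigenspace_of_forall_mapsTo f
    (fun i j φ => Module.End.mapsTo_maxGenEigenspace_of_comm (hf j i) φ)
  refine (h.comp hχ).mono fun μ => ?_
  refine le_iInf fun i => (hW μ i).trans ?_
  exact Module.End.eigenspace_le_maxGenEigenspace

/-- The linear map which acts on the summand `W i` of a direct sum decomposition by `c i`. -/
def actOnSummands {ι : Type*} [DecidableEq ι] (W : ι → Submodule K V) (h : DirectSum.IsInternal W)
    (c : ι → K) : Module.End K V :=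
  (DirectSum.toModule K ι V fun i => c i • (W i).subtype) ∘ₗ
    (LinearEquiv.ofBijective (DirectSum.coeLinearMap W) h).symm.toLinearMap

theorem actOnSummands_apply {ι : Type*} [DecidableEq ι] (W : ι → Submodule K V)
    (h : DirectSum.IsInternal W) (c : ι → K) (i : ι) {x : V} (hx : x ∈ W i) :
    actOnSummands W h c x = c i • x := by
  have h1 : (LinearEquiv.ofBijective (DirectSum.coeLinearMap W) h).symm x =
      DirectSum.lof K ι (fun i => W i) i ⟨x, hx⟩ := by
    rw [LinearEquiv.symm_apply_eq]
    exact (DirectSum.coeLinearMap_lof W i ⟨x, hx⟩).symm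
  simp [actOnSummands, h1]

variable {A : Type*} [Ring A] [Algebra K A] [Module A V] [IsScalarTower K A V]

theorem weight_shift {w e : A} {c t : K} {x : V} (h : w * e = c • (e * w)) (hx : w • x = t • x) :
    w • (e • x) = (t * c) • (e • x) := by
  rw [← mul_smul, h, smul_assoc, mul_smul, hx, ← algebraMap_smul A t x, ← mul_smul,
    ← Algebra.commutes t e, mul_smul, algebraMap_smul, smul_smul, mul_comm]

/-- A subspace stable under generators is stable under the generated algebra. -/
theorem stable_of_gen {m : ℕ} (φ : FreeAlgebra K (Gen m) →ₐ[K] A) (S : Submodule K V)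
    (hS : ∀ g : Gen m, ∀ x ∈ S, φ (gen K g) • x ∈ S) (u : FreeAlgebra K (Gen m)) :
    ∀ x ∈ S, φ u • x ∈ S := by
  induction u using FreeAlgebra.induction with
  | grade0 c =>
    intro x hx
    rw [AlgHom.commutes, algebraMap_smul]
    exact S.smul_mem c hx
  | grade1 g => exact hS g
  | mul a b ha hb =>
    intro x hx
    rw [map_mul, mul_smul]
    exact ha _ (hb x hx)
  | add a b ha hb =>
    intro x hx
    rw [map_add, add_smul]
    exact S.add_mem (ha x hx) (hb x hx)

end Generic

section Modules

variable {X : DynkinType} {K : Type*} [Field K] [CharZero K] (P : Parameters X K)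

/-- The left ideal generated by all `e i`, `ω i - ϱ^η(ω i)` and `ω' i - ϱ^η(ω' i)`. -/
def vermaIdeal (η : X.Weight) : Submodule (QuantumGroup P) (QuantumGroup P) :=
  Submodule.span (QuantumGroup P)
    (Set.range (fun i => ug P (.e i)) ∪
      Set.range (fun i => ug P (.om i) - algebraMap K (QuantumGroup P) (P.weightOm η i)) ∪
      Set.range (fun i => ug P (.omP i) - algebraMap K (QuantumGroup P) (P.weightOmP η i)))

/-- The Verma module `M(η)`. The quotient of `U` by the left ideal above is the module induced
from the one-dimensional representation of the subalgebra generated by all `e i`, `ω i ^ ±1`,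
`ω' i ^ ±1` on which the `e i` act by zero and the `ω i`, `ω' i` act through `ϱ^η`. -/
abbrev VermaModule (η : X.Weight) : Type _ := QuantumGroup P ⧸ vermaIdeal P η

/-- The largest proper submodule of the Verma module. -/
def maxSubmodule (η : X.Weight) : Submodule (QuantumGroup P) (VermaModule P η) :=
  sSup {N | N ≠ ⊤}

/-- The irreducible quotient `L(η)` of the Verma module `M(η)`. -/
def SimpleModule (η : X.Weight) : Type _ := VermaModule P η ⧸ maxSubmodule P η

instance (η : X.Weight) : AddCommGroup (SimpleModule P η) :=
  inferInstanceAs (AddCommGroup (VermaModule P η ⧸ maxSubmodule P η))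

instance (η : X.Weight) : Module (QuantumGroup P) (SimpleModule P η) :=
  inferInstanceAs (Module (QuantumGroup P) (VermaModule P η ⧸ maxSubmodule P η))

instance (η : X.Weight) : Module K (SimpleModule P η) :=
  inferInstanceAs (Module K (VermaModule P η ⧸ maxSubmodule P η))

instance (η : X.Weight) : IsScalarTower K (QuantumGroup P) (SimpleModule P η) :=
  inferInstanceAs (IsScalarTower K (QuantumGroup P) (VermaModule P η ⧸ maxSubmodule P η))

/-- The representation `ζ` of `U` on `L(η)`. -/
def rep (η : X.Weight) : QuantumGroup P →ₐ[K] Module.End K (SimpleModule P η) :=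
  Algebra.lsmul K K (SimpleModule P η)

/-- The weight space `L(η)_μ`, on which `ω i` and `ω' i` act by `ϱ^μ(ω i)` and `ϱ^μ(ω' i)`. -/
def weightSpace (η μ : X.Weight) : Submodule K (SimpleModule P η) :=
  ⨅ i, (rep P η (ug P (.om i))).eigenspace (P.weightOm μ i) ⊓
    (rep P η (ug P (.omP i))).eigenspace (P.weightOmP μ i)

theorem mem_weightSpace (η μ : X.Weight) (x : SimpleModule P η) : x ∈ weightSpace P η μ ↔
    ∀ i, ug P (.om i) • x = P.weightOm μ i • x ∧ ug P (.omP i) • x = P.weightOmP μ i • x := by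
  simp [weightSpace, rep, Submodule.mem_iInf]

theorem weightSpace_iSupIndep (η : X.Weight) : iSupIndep (weightSpace P η) := by
  refine eigen_iSupIndep (fun i => rep P η (ug P (.om i))) (fun i j => ?_) P.weightOm
    P.weightOm_injective _ (fun μ i => (iInf_le _ i).trans inf_le_left)
  rw [Commute, SemiconjBy, ← map_mul, ← map_mul, ug_comm P (.om i) (.om j) trivial trivial]

theorem e_smul_mem (η μ : X.Weight) (i : Fin X.rank) {x : SimpleModule P η}
    (hx : x ∈ weightSpace P η μ) :
    ug P (.e i) • x ∈ weightSpace P η (μ + X.simpleRoot i) := by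
  rw [mem_weightSpace] at hx ⊢
  intro j
  rw [P.weightOm_add, P.weightOmP_add, P.weightOm_simpleRoot, P.weightOmP_simpleRoot]
  exact ⟨weight_shift (V := SimpleModule P η) (om_e P j i) (hx j).1, weight_shift (V := SimpleModule P η) (omP_e P j i) (hx j).2⟩

theorem f_smul_mem (η μ : X.Weight) (i : Fin X.rank) {x : SimpleModule P η}
    (hx : x ∈ weightSpace P η (μ + X.simpleRoot i)) :
    ug P (.f i) • x ∈ weightSpace P η μ := by
  rw [mem_weightSpace] at hx ⊢
  intro j
  obtain ⟨h1, h2⟩ := hx j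
  rw [P.weightOm_add, P.weightOm_simpleRoot] at h1
  rw [P.weightOmP_add, P.weightOmP_simpleRoot] at h2
  have h3 := weight_shift (V := SimpleModule P η) (om_f P j i) h1
  have h4 := weight_shift (V := SimpleModule P η) (omP_f P j i) h2
  rw [mul_assoc, mul_inv_cancel₀ (P.a_ne_zero j i), mul_one] at h3
  rw [mul_assoc, inv_mul_cancel₀ (P.a_ne_zero i j), mul_one] at h4
  exact ⟨h3, h4⟩

theorem toral_smul_mem (η μ : X.Weight) (g : Gen X.rank) (hg : g.IsToral) {x : SimpleModule P η}
    (hx : x ∈ weightSpace P η μ) : ug P g • x ∈ weightSpace P η μ := by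
  rw [mem_weightSpace] at hx ⊢
  intro j
  have h1 := weight_shift (K := K) (V := SimpleModule P η) (c := 1) (w := ug P (.om j)) (e := ug P g)
    (by rw [one_smul]; exact ug_comm P (.om j) g trivial hg) (hx j).1
  have h2 := weight_shift (K := K) (V := SimpleModule P η) (c := 1) (w := ug P (.omP j)) (e := ug P g)
    (by rw [one_smul]; exact ug_comm P (.omP j) g trivial hg) (hx j).2
  rw [mul_one] at h1 h2
  exact ⟨h1, h2⟩

/-- The image of `1` in `L(η)`, a generator of highest weight `η`. -/
def highestVector (η : X.Weight) : SimpleModule P η :=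
  (maxSubmodule P η).mkQ ((vermaIdeal P η).mkQ 1)

theorem smul_highestVector (η : X.Weight) (u : QuantumGroup P) : u • highestVector P η =
    (maxSubmodule P η).mkQ ((vermaIdeal P η).mkQ u) := by
  have h := ((maxSubmodule P η).mkQ.comp (vermaIdeal P η).mkQ).map_smul u 1
  rw [smul_eq_mul, mul_one] at h
  exact h.symm

theorem eq_smul_highestVector (η : X.Weight) (x : SimpleModule P η) :
    ∃ u : QuantumGroup P, x = u • highestVector P η := by
  obtain ⟨y, rfl⟩ := (maxSubmodule P η).mkQ_surjective x
  obtain ⟨u, rfl⟩ := (vermaIdeal P η).mkQ_surjective y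
  exact ⟨u, (smul_highestVector P η u).symm⟩

theorem smul_highestVector_of_mem (η : X.Weight) {u : QuantumGroup P} (hu : u ∈ vermaIdeal P η) :
    u • highestVector P η = 0 := by
  have h : (vermaIdeal P η).mkQ u = 0 := (Submodule.Quotient.mk_eq_zero _).mpr hu
  rw [smul_highestVector, h]
  exact map_zero _

theorem highestVector_mem (η : X.Weight) : highestVector P η ∈ weightSpace P η η := by
  rw [mem_weightSpace]
  intro j
  constructor
  · have h := smul_highestVector_of_mem P η
      (Submodule.subset_span (Or.inl (Or.inr (Set.mem_range_self j))))
    rwa [sub_smul, algebraMap_smul, sub_eq_zero] at h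
  · have h := smul_highestVector_of_mem P η
      (Submodule.subset_span (Or.inr (Set.mem_range_self j)))
    rwa [sub_smul, algebraMap_smul, sub_eq_zero] at h

theorem weightSpace_iSup (η : X.Weight) : ⨆ μ, weightSpace P η μ = ⊤ := by
  rw [eq_top_iff]
  rintro x -
  obtain ⟨u, rfl⟩ := eq_smul_highestVector P η x
  obtain ⟨u, rfl⟩ := RingQuot.mkAlgHom_surjective K (Rel P) u
  refine stable_of_gen (RingQuot.mkAlgHom K (Rel P)) _ ?_ u _
    (Submodule.mem_iSup_of_mem η (highestVector_mem P η))
  intro g x hx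
  induction hx using Submodule.iSup_induction' with
  | mem μ x hx =>
    cases g with
    | e i => exact Submodule.mem_iSup_of_mem _ (e_smul_mem P η μ i hx)
    | f i =>
      refine Submodule.mem_iSup_of_mem (μ - X.simpleRoot i) (f_smul_mem P η _ i ?_)
      rwa [sub_add_cancel]
    | om i => exact Submodule.mem_iSup_of_mem μ (toral_smul_mem P η μ (.om i) trivial hx)
    | omInv i => exact Submodule.mem_iSup_of_mem μ (toral_smul_mem P η μ (.omInv i) trivial hx)
    | omP i => exact Submodule.mem_iSup_of_mem μ (toral_smul_mem P η μ (.omP i) trivial hx)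
    | omPInv i => exact Submodule.mem_iSup_of_mem μ (toral_smul_mem P η μ (.omPInv i) trivial hx)
  | zero => rw [smul_zero]; exact Submodule.zero_mem _
  | add x y _ _ hx hy => rw [smul_add]; exact Submodule.add_mem _ hx hy

/-- The weight space decomposition of `L(η)`. -/
theorem weightSpace_isInternal (η : X.Weight) : DirectSum.IsInternal (weightSpace P η) :=
  DirectSum.isInternal_submodule_of_iSupIndep_of_iSup_eq_top (weightSpace_iSupIndep P η)
    (weightSpace_iSup P η)

/-- The linear map `Θ` on `L(η)`, which acts on the weight space `L(η)_μ` by the scalar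
`(r s⁻¹) ^ (-(2 / ℓ) (ρ, μ))`. -/
def theta (η : X.Weight) : Module.End K (SimpleModule P η) :=
  actOnSummands (weightSpace P η) (weightSpace_isInternal P η) P.thetaScalar

theorem theta_apply (η μ : X.Weight) {x : SimpleModule P η} (hx : x ∈ weightSpace P η μ) :
    theta P η x = P.thetaScalar μ • x :=
  actOnSummands_apply _ _ _ μ hx

/-- The map `(id ⊗ ζ) ∘ Δ`. -/
def comulRep (η : X.Weight) :
    QuantumGroup P →ₐ[K] QuantumGroup P ⊗[K] Module.End K (SimpleModule P η) :=
  (Algebra.TensorProduct.map (AlgHom.id K (QuantumGroup P)) (rep P η)).comp (comul P)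

/-- The partial trace `tr₂ = id ⊗ tr`. -/
def partialTrace (η : X.Weight) :
    QuantumGroup P ⊗[K] Module.End K (SimpleModule P η) →ₗ[K] QuantumGroup P :=
  (TensorProduct.rid K (QuantumGroup P)).toLinearMap ∘ₗ
    (LinearMap.trace K (SimpleModule P η)).lTensor (QuantumGroup P)

end Modules

end TwoParameter

end

/-! Write $\tau(Y)=\mathrm{tr}_2(Y(1\otimes\Theta))$, so that $c=\tau(\Gamma)$. Two properties of
$\tau$ carry the proof. First, $\tau$ is a map of $U$-bimodules, where $U$ acts through $u\otimes
1$. Second, it is cyclic in the second factor up to a scalar: if $\Theta B=kB\Theta$, then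
$\tau((1\otimes B)Y)=k\,\tau(Y(1\otimes B))$, by cyclicity of the ordinary trace.

The role of $\Theta$ is to provide the right scalars $k$. Since $\frac2\ell(\rho,\alpha_i)=d_i$ and
$a_{ii}=(rs^{-1})^{d_i}$, raising the weight by $\alpha_i$ multiplies the scalar of $\Theta$ by
$a_{ii}^{-1}$. Hence, on $L(\lambda)$, $\Theta$ commutes with $\omega_i,\omega_i'$, while $\Theta
e_i=a_{ii}^{-1}e_i\Theta$ and $\Theta f_i=a_{ii}f_i\Theta$. In other words, conjugation by $\Theta$
implements the square of the antipode, and $\tau$ is a quantum trace.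

It is enough that $c$ commutes with generators. For a group-like $w$ acting by $W$, one writes
$w\otimes1=(w\otimes W)(1\otimes W^{-1})$, moves $w\otimes W$ through $\Gamma$ and cancels $W$
against $W^{-1}$ by cyclicity (`commute_twistedTrace_of_groupLike`).

For $e_i$, with action $E$ and $\Delta(e_i)=e_i\otimes1+\omega_i\otimes e_i$, applying $\tau$ to the
hypothesis reduces the claim to $\tau((\omega_i\otimes E)\Gamma)=\tau(\Gamma(\omega_i\otimes E))$.
Cyclicity produces a factor $a_{ii}^{-1}$, and moving $\omega_i$ past $\tau(\Gamma(1\otimes E))$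
produces $a_{ii}$ (`commute_twistedTrace_of_skewPrimitive`).

For $f_i$, with $\Delta(f_i)=1\otimes f_i+f_i\otimes\omega_i'$, the hypothesis is multiplied on the
right by $1\otimes\omega_i'^{-1}$ before $\tau$ is applied. The terms containing $1\otimes f_i$ then
cancel, because $\Theta$ and $\omega_i'$ commute with $f_i$ up to the same scalar
(`commute_twistedTrace_of_skewPrimitive'`). -/

noncomputable section

namespace TwoParameter

/-! ### Twisted partial traces over an arbitrary algebra -/

section PartialTrace

variable {K A V : Type*} [Field K] [Ring A] [Algebra K A] [AddCommGroup V] [Module K V]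

/-- The partial trace `Y ↦ (id ⊗ tr) (Y (1 ⊗ T))` twisted by an endomorphism `T`. -/
def twistedTrace (T : Module.End K V) : A ⊗[K] Module.End K V →ₗ[K] A :=
  ((TensorProduct.rid K A).toLinearMap ∘ₗ (LinearMap.trace K V).lTensor A) ∘ₗ
    LinearMap.mulRight K ((1 : A) ⊗ₜ[K] T)

variable (T : Module.End K V)

theorem twistedTrace_tmul (u : A) (B : Module.End K V) :
    twistedTrace T (u ⊗ₜ[K] B) = LinearMap.trace K V (B * T) • u := by
  simp [twistedTrace, Algebra.TensorProduct.tmul_mul_tmul]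

/-- The trace only sees the second tensor factor. With its right-handed companion below, this makes
`twistedTrace T` a bimodule map over `A`; on the right this also uses that `u ⊗ 1` commutes with `1
⊗ T`. -/
theorem twistedTrace_tmul_one_mul (u : A) (Y : A ⊗[K] Module.End K V) :
    twistedTrace T ((u ⊗ₜ[K] 1) * Y) = u * twistedTrace T Y := by
  induction Y using TensorProduct.induction_on with
  | zero => simp
  | tmul v B => simp [Algebra.TensorProduct.tmul_mul_tmul, twistedTrace_tmul]
  | add Y Z hY hZ => rw [mul_add, map_add, map_add, mul_add, hY, hZ]

theorem twistedTrace_mul_tmul_one (u : A) (Y : A ⊗[K] Module.End K V) :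
    twistedTrace T (Y * (u ⊗ₜ[K] 1)) = twistedTrace T Y * u := by
  induction Y using TensorProduct.induction_on with
  | zero => simp
  | tmul v B => simp [Algebra.TensorProduct.tmul_mul_tmul, twistedTrace_tmul]
  | add Y Z hY hZ => rw [add_mul, map_add, map_add, add_mul, hY, hZ]

/-- Cyclicity of the twisted trace in the second tensor factor. -/
theorem twistedTrace_one_tmul_mul {B : Module.End K V} {c : K} (h : T * B = c • (B * T))
    (Y : A ⊗[K] Module.End K V) :
    twistedTrace T ((1 ⊗ₜ[K] B) * Y) = c • twistedTrace T (Y * (1 ⊗ₜ[K] B)) := by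
  induction Y using TensorProduct.induction_on with
  | zero => simp
  | tmul v D =>
    -- The trace rotates `B` to the far right, next to `T`, and moving it back across `T` costs the
    -- factor `c`. Cyclicity of `LinearMap.trace` needs no finiteness of `V`.
    have key : LinearMap.trace K V (B * D * T) = c * LinearMap.trace K V (D * B * T) := by
      rw [mul_assoc, LinearMap.trace_mul_comm, mul_assoc, h, mul_smul_comm, map_smul, mul_assoc,
        smul_eq_mul]
    simp only [Algebra.TensorProduct.tmul_mul_tmul, twistedTrace_tmul, one_mul, mul_one, key,
      mul_smul]
  | add Y Z hY hZ => rw [mul_add, add_mul, map_add, map_add, smul_add, hY, hZ]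

variable {T} {Γ : A ⊗[K] Module.End K V}

/-- The twisted trace of an element commuting with a group-like element `w ⊗ W` commutes with `w`. -/
theorem commute_twistedTrace_of_groupLike {w : A} {W W' : Module.End K V} (hW : W * W' = 1)
    (hW' : W' * W = 1) (hT : T * W = W * T) (hΓ : Γ * (w ⊗ₜ[K] W) = (w ⊗ₜ[K] W) * Γ) :
    twistedTrace T Γ * w = w * twistedTrace T Γ := by
  have e1 : (w ⊗ₜ[K] (1 : Module.End K V)) = (w ⊗ₜ[K] W) * (1 ⊗ₜ[K] W') := by
    rw [Algebra.TensorProduct.tmul_mul_tmul, mul_one, hW]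
  have e2 : (w ⊗ₜ[K] W) = (w ⊗ₜ[K] (1 : Module.End K V)) * (1 ⊗ₜ[K] W) := by
    rw [Algebra.TensorProduct.tmul_mul_tmul, mul_one, one_mul]
  have e3 : ((1 : A) ⊗ₜ[K] W') * (1 ⊗ₜ[K] W) = 1 := by
    rw [Algebra.TensorProduct.tmul_mul_tmul, mul_one, hW', Algebra.TensorProduct.one_def]
  have hT' : T * W = (1 : K) • (W * T) := by rw [one_smul, hT]
  -- Only `W` is inverted, never `w`: the factor `w` leaves the trace on the left by linearity, and
  -- the remaining `W` returns cyclically to meet `W'`.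
  rw [← twistedTrace_mul_tmul_one, e1, ← mul_assoc, hΓ, e2, mul_assoc, mul_assoc,
    twistedTrace_tmul_one_mul, twistedTrace_one_tmul_mul T hT', mul_assoc, e3, mul_one, one_smul]

/-- The twisted trace of an element commuting with `e ⊗ 1 + w ⊗ E` commutes with `e`. -/
theorem commute_twistedTrace_of_skewPrimitive {e w : A} {E W W' : Module.End K V} {c : K}
    (hW : W * W' = 1) (hW' : W' * W = 1) (hTW : T * W = W * T) (hc : c ≠ 0)
    (hTE : T * E = c⁻¹ • (E * T)) (hWE : W * E = c • (E * W))
    (hΓw : Γ * (w ⊗ₜ[K] W) = (w ⊗ₜ[K] W) * Γ)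
    (hΓe : Γ * (e ⊗ₜ[K] 1 + w ⊗ₜ[K] E) = (e ⊗ₜ[K] 1 + w ⊗ₜ[K] E) * Γ) :
    twistedTrace T Γ * e = e * twistedTrace T Γ := by
  have e2 : (w ⊗ₜ[K] E) = (w ⊗ₜ[K] (1 : Module.End K V)) * (1 ⊗ₜ[K] E) := by
    rw [Algebra.TensorProduct.tmul_mul_tmul, mul_one, one_mul]
  have e3 : (w ⊗ₜ[K] E) = (1 ⊗ₜ[K] E) * (w ⊗ₜ[K] (1 : Module.End K V)) := by
    rw [Algebra.TensorProduct.tmul_mul_tmul, mul_one, one_mul]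
  -- `Γ (1 ⊗ E)` commutes with `w ⊗ W` up to the factor `c`
  have hWE' : ((w ⊗ₜ[K] W) * (Γ * (1 ⊗ₜ[K] E))) = c • (Γ * (1 ⊗ₜ[K] E) * (w ⊗ₜ[K] W)) := by
    rw [← mul_assoc, ← hΓw, mul_assoc, mul_assoc, Algebra.TensorProduct.tmul_mul_tmul,
      Algebra.TensorProduct.tmul_mul_tmul, hWE, mul_one, one_mul, TensorProduct.tmul_smul,
      mul_smul_comm]
  -- This is the group-like argument again, for `Γ (1 ⊗ E)` in place of `Γ`. That element commutes
  -- with `w ⊗ W` only up to `c`, and the factor survives in the trace.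
  have e4 : w * twistedTrace T (Γ * (1 ⊗ₜ[K] E)) = c • (twistedTrace T (Γ * (1 ⊗ₜ[K] E)) * w) := by
    have h1 : (w ⊗ₜ[K] (1 : Module.End K V)) = (1 ⊗ₜ[K] W') * (w ⊗ₜ[K] W) := by
      rw [Algebra.TensorProduct.tmul_mul_tmul, one_mul, hW']
    have h2 : (w ⊗ₜ[K] W) = (w ⊗ₜ[K] (1 : Module.End K V)) * (1 ⊗ₜ[K] W) := by
      rw [Algebra.TensorProduct.tmul_mul_tmul, mul_one, one_mul]
    have h3 : ((1 : A) ⊗ₜ[K] W) * (1 ⊗ₜ[K] W') = 1 := by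
      rw [Algebra.TensorProduct.tmul_mul_tmul, mul_one, hW, Algebra.TensorProduct.one_def]
    have hT'' : T * W' = (1 : K) • (W' * T) := by
      rw [one_smul]
      calc T * W' = W' * (W * T) * W' := by rw [← mul_assoc W', hW', one_mul]
        _ = W' * T := by rw [← hTW, mul_assoc, mul_assoc, hW, mul_one]
    rw [← twistedTrace_tmul_one_mul, h1, mul_assoc, hWE', twistedTrace_one_tmul_mul T hT'',
      one_smul, smul_mul_assoc, map_smul, h2, ← mul_assoc, mul_assoc _ _ (1 ⊗ₜ[K] W'), h3,
      mul_one, twistedTrace_mul_tmul_one]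
  have h := congrArg (twistedTrace T) hΓe
  rw [mul_add, add_mul, map_add, map_add, twistedTrace_mul_tmul_one, twistedTrace_tmul_one_mul] at h
  -- The two factors cancel: cyclic rotation of `E` past `T` gives `c⁻¹`, and moving `w` from the
  -- left to the right of the trace gives `c` by `e4`. This is why `hTE` and `hWE` carry mutually
  -- inverse scalars.
  have h5 : twistedTrace T ((w ⊗ₜ[K] E) * Γ) = twistedTrace T (Γ * (w ⊗ₜ[K] E)) := by
    rw [e2, mul_assoc, twistedTrace_tmul_one_mul, twistedTrace_one_tmul_mul T hTE, mul_smul_comm,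
      e4, smul_smul, inv_mul_cancel₀ hc, one_smul, ← e2, e3, ← mul_assoc,
      twistedTrace_mul_tmul_one]
  rw [h5] at h
  exact add_right_cancel h

/-- The twisted trace of an element commuting with `1 ⊗ F + f ⊗ W` commutes with `f`. -/
theorem commute_twistedTrace_of_skewPrimitive' {f : A} {F W W' : Module.End K V} {c : K}
    (hW : W * W' = 1) (hW' : W' * W = 1) (hTW : T * W = W * T)
    (hTF : T * F = c • (F * T)) (hWF : W * F = c • (F * W))
    (hΓf : Γ * (1 ⊗ₜ[K] F + f ⊗ₜ[K] W) = (1 ⊗ₜ[K] F + f ⊗ₜ[K] W) * Γ) :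
    twistedTrace T Γ * f = f * twistedTrace T Γ := by
  have hT' : T * W = (1 : K) • (W * T) := by rw [one_smul, hTW]
  have h1 : (f ⊗ₜ[K] W) = (f ⊗ₜ[K] (1 : Module.End K V)) * (1 ⊗ₜ[K] W) := by
    rw [Algebra.TensorProduct.tmul_mul_tmul, mul_one, one_mul]
  have h2 : (f ⊗ₜ[K] W) * (1 ⊗ₜ[K] W') = f ⊗ₜ[K] (1 : Module.End K V) := by
    rw [Algebra.TensorProduct.tmul_mul_tmul, mul_one, hW]
  have h3 : ((1 : A) ⊗ₜ[K] W') * (1 ⊗ₜ[K] W) = 1 := by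
    rw [Algebra.TensorProduct.tmul_mul_tmul, mul_one, hW', Algebra.TensorProduct.one_def]
  have hWF' : F * W' = c • (W' * F) := by
    calc F * W' = W' * (W * F) * W' := by rw [← mul_assoc W', hW', one_mul]
      _ = c • (W' * F) := by
        rw [hWF, mul_smul_comm, smul_mul_assoc, mul_assoc, mul_assoc, hW, mul_one]
  have h4 : twistedTrace T ((f ⊗ₜ[K] W) * Γ * (1 ⊗ₜ[K] W')) = f * twistedTrace T Γ := by
    rw [h1, mul_assoc, mul_assoc, twistedTrace_tmul_one_mul, twistedTrace_one_tmul_mul T hT',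
      mul_assoc, h3, mul_one, one_smul]
  -- Rotating `F` past `T` gives `c` and leaves `W' F` behind; by `hWF'` this `c` is exactly what
  -- turns `W' F` into `F W'`. Hence `hTF` and `hWF` must share one scalar, in contrast to the case
  -- of `e`.
  have h5 : twistedTrace T ((1 ⊗ₜ[K] F) * Γ * (1 ⊗ₜ[K] W')) =
      twistedTrace T (Γ * (1 ⊗ₜ[K] F) * (1 ⊗ₜ[K] W')) := by
    rw [mul_assoc, twistedTrace_one_tmul_mul T hTF, mul_assoc, mul_assoc,
      Algebra.TensorProduct.tmul_mul_tmul, Algebra.TensorProduct.tmul_mul_tmul, hWF',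
      TensorProduct.tmul_smul, mul_smul_comm, map_smul]
  -- Multiplying by `1 ⊗ W'` before taking the trace turns `Γ (f ⊗ W)` into `Γ (f ⊗ 1)`, from which
  -- `f` can be extracted on the right.
  have h := congrArg (fun Y => twistedTrace T (Y * (1 ⊗ₜ[K] W'))) hΓf
  simp only [mul_add, add_mul, map_add] at h
  rw [h4, h5, mul_assoc Γ (f ⊗ₜ[K] W), h2, twistedTrace_mul_tmul_one] at h
  exact add_left_cancel h

end PartialTrace

/-! ### The scalars of Θ under a shift by a simple root -/

variable {X : DynkinType} {K : Type*} [Field K] [CharZero K] (P : Parameters X K)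

theorem DynkinType.ell_ne_zero (X : DynkinType) : X.ell ≠ 0 := by
  cases X <;> simp [DynkinType.ell]

/-- This is $(\rho,\alpha_j)=\frac\ell2 d_j$, which holds because the coefficients of $\rho$ in the
fundamental weights are all 1. The normalization $2/\ell$ then disappears, and the exponent defining
$\Theta$ becomes an integral combination of the simple-root coordinates. -/
theorem DynkinType.form_rho (X : DynkinType) (η : X.Weight) :
    -(2 / X.ell) * X.form (X.simpleCoord X.rho) (X.simpleCoord η) =
      -∑ j, (X.d j : ℚ) * X.simpleCoord η j := by
  have h : X.form (X.simpleCoord X.rho) (X.simpleCoord η) =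
      X.ell / 2 * ∑ j, (X.d j : ℚ) * X.simpleCoord η j := by
    rw [DynkinType.form, Finset.sum_comm, Finset.mul_sum]
    refine Finset.sum_congr rfl fun j _ => ?_
    have h1 := X.cartan_simpleCoord X.rho j
    have h2 : (X.rho j : ℚ) = 1 := by simp [DynkinType.rho]
    rw [h2] at h1
    -- For fixed `j` the inner sum runs down column `j` of the Cartan matrix. Symmetry of
    -- $d_ic_{ij}$ converts it to a sum along row `j`, which `cartan_simpleCoord` evaluates as the
    -- `j`-th coefficient of $\rho$.
    calc _ = X.ell / 2 * ((X.d j : ℚ) * X.simpleCoord η j) *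
          ∑ i, (X.cartan j i : ℚ) * X.simpleCoord X.rho i := by
          rw [Finset.mul_sum]
          refine Finset.sum_congr rfl fun i _ => ?_
          have h3 : (X.d i : ℚ) * X.cartan i j = X.d j * X.cartan j i := by
            exact_mod_cast X.symm_aux i j
          linear_combination X.simpleCoord X.rho i * X.ell / 2 * X.simpleCoord η j * h3
      _ = _ := by rw [h1, mul_one]
  rw [h]
  have := X.ell_ne_zero
  field_simp

/-- The exponent drops by $d_i$, and $(rs^{-1})^{-d_i}=a_{ii}^{-1}$ because
$\langle\alpha_i,\alpha_i\rangle=d_i$. -/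
theorem Parameters.thetaScalar_add_simpleRoot (μ : X.Weight) (i : Fin X.rank) :
    P.thetaScalar (μ + X.simpleRoot i) = (P.a i i)⁻¹ * P.thetaScalar μ := by
  obtain ⟨z, hz⟩ := X.exists_coord μ
  have hb : P.rRoot * P.sRoot⁻¹ ≠ 0 := mul_ne_zero P.rRoot_ne_zero (inv_ne_zero P.sRoot_ne_zero)
  -- `fracPow` takes the floor of $m^2$ times the exponent, so it is additive only where that
  -- product is an integer. Here `z` holds the integers $m^2\mu_j$, and both exponents are rewritten
  -- as integers.
  have h1 : -(2 / X.ell) * X.form (X.simpleCoord X.rho) (X.simpleCoord μ) *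
      (X.latticeIndex : ℚ) ^ 2 = ((-∑ j, X.d j * z j : ℤ) : ℚ) := by
    rw [X.form_rho, neg_mul, Finset.sum_mul]
    push_cast
    congr 1
    exact Finset.sum_congr rfl fun j _ => by rw [mul_assoc, hz]
  have h2 : -(2 / X.ell) * X.form (X.simpleCoord X.rho) (X.simpleCoord (μ + X.simpleRoot i)) *
      (X.latticeIndex : ℚ) ^ 2 =
      ((-(X.d i * (X.latticeIndex ^ 2 : ℕ)) + -∑ j, X.d j * z j : ℤ) : ℚ) := by
    rw [X.form_rho, X.simpleCoord_add, Int.cast_add, ← h1, X.form_rho]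
    simp only [Pi.add_apply, mul_add, Finset.sum_add_distrib, X.simpleCoord_simpleRoot, mul_ite,
      mul_one, mul_zero, Finset.sum_ite_eq', Finset.mem_univ, if_true]
    push_cast
    ring
  -- The base is an $m^2$-th root of $rs^{-1}$, so the factor $m^2$ in the exponent is absorbed.
  have h3 : (P.rRoot * P.sRoot⁻¹) ^ (-(X.d i * ((X.latticeIndex ^ 2 : ℕ) : ℤ))) = (P.a i i)⁻¹ := by
    rw [zpow_neg, mul_comm (X.d i), zpow_mul, zpow_natCast, mul_pow, inv_pow, P.rRoot_pow,
      P.sRoot_pow, mul_zpow, Parameters.a, X.euler_self, inv_zpow, zpow_neg]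
  rw [Parameters.thetaScalar, Parameters.thetaScalar, fracPow_eq X _ h2, fracPow_eq X _ h1,
    zpow_add₀ hb, h3]

/-! ### Commutation of Θ with the action of the generators -/

/-- Two endomorphisms of `L(η)` agreeing on all weight spaces are equal. -/
theorem end_ext_weightSpace (η : X.Weight) {S T : Module.End K (SimpleModule P η)}
    (h : ∀ μ, ∀ x ∈ weightSpace P η μ, S x = T x) : S = T := by
  -- The locus where `S` and `T` agree is a subspace containing every weight space, and the weight
  -- spaces span.
  have h1 : ⨆ μ, weightSpace P η μ ≤ LinearMap.eqLocus S T := iSup_le fun μ x hx => h μ x hx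
  rw [weightSpace_iSup] at h1
  exact LinearMap.ext fun x => h1 Submodule.mem_top

theorem rep_apply (η : X.Weight) (u : QuantumGroup P) (x : SimpleModule P η) :
    rep P η u x = u • x := rfl

/-- Toral generators preserve each weight space, and Θ is a scalar there. -/
theorem theta_mul_toral (η : X.Weight) (g : Gen X.rank) (hg : g.IsToral) :
    theta P η * rep P η (ug P g) = rep P η (ug P g) * theta P η := by
  refine end_ext_weightSpace P η fun μ x hx => ?_
  rw [Module.End.mul_apply, Module.End.mul_apply, theta_apply P η μ hx, map_smul, rep_apply,
    theta_apply P η μ (toral_smul_mem P η μ g hg hx)]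

/-- The factor is the change of the scalar of Θ under the weight shift by $\alpha_i$. It is inverse
to the one in $\omega_ie_i=a_{ii}e_i\omega_i$, as the argument for $e_i$ requires. -/
theorem theta_mul_e (η : X.Weight) (i : Fin X.rank) :
    theta P η * rep P η (ug P (.e i)) = (P.a i i)⁻¹ • (rep P η (ug P (.e i)) * theta P η) := by
  refine end_ext_weightSpace P η fun μ x hx => ?_
  rw [LinearMap.smul_apply, Module.End.mul_apply, Module.End.mul_apply, theta_apply P η μ hx,
    map_smul, rep_apply, theta_apply P η _ (e_smul_mem P η μ i hx), P.thetaScalar_add_simpleRoot,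
    mul_smul]

theorem theta_mul_f (η : X.Weight) (i : Fin X.rank) :
    theta P η * rep P η (ug P (.f i)) = P.a i i • (rep P η (ug P (.f i)) * theta P η) := by
  refine end_ext_weightSpace P η fun μ x hx => ?_
  -- With the weight of `x` written as $\nu+\alpha_i$, the image under $f_i$ has weight $\nu$, and
  -- the shift formula for the scalar of Θ applies without subtraction.
  obtain ⟨ν, rfl⟩ : ∃ ν, μ = ν + X.simpleRoot i := ⟨μ - X.simpleRoot i, by abel⟩
  rw [LinearMap.smul_apply, Module.End.mul_apply, Module.End.mul_apply, theta_apply P η _ hx,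
    map_smul, rep_apply, theta_apply P η _ (f_smul_mem P η ν i hx), P.thetaScalar_add_simpleRoot,
    smul_smul, mul_inv_cancel_left₀ (P.a_ne_zero i i)]

/-! ### Centrality of the twisted trace of Γ -/

/-- An element of `U` commuting with the generators is central. -/
theorem mem_center_of_commute_ug {c : QuantumGroup P} (h : ∀ g, c * ug P g = ug P g * c) :
    c ∈ Subalgebra.center K (QuantumGroup P) := by
  rw [Subalgebra.mem_center_iff]
  intro b
  obtain ⟨u, rfl⟩ := RingQuot.mkAlgHom_surjective K (Rel P) b
  induction u using FreeAlgebra.induction with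
  | grade0 t => rw [AlgHom.commutes, Algebra.commutes]
  | grade1 g => exact (h g).symm
  | mul a b ha hb => rw [map_mul, mul_assoc, hb, ← mul_assoc, ha, mul_assoc]
  | add a b ha hb => rw [map_add, add_mul, mul_add, ha, hb]

/-- An element commuting with `w` commutes with the inverse of `w`. -/
theorem mul_inverse_comm {M : Type*} [Monoid M] {c w w' : M} (h1 : w * w' = 1) (h2 : w' * w = 1)
    (h : c * w = w * c) : c * w' = w' * c := by
  calc c * w' = w' * (w * c) * w' := by rw [← mul_assoc w', h2, one_mul]
    _ = w' * c := by rw [← h, mul_assoc, mul_assoc, h1, mul_one]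

theorem comulRep_ug (η : X.Weight) (g : Gen X.rank) : comulRep P η (ug P g) =
    Algebra.TensorProduct.map (AlgHom.id K (QuantumGroup P)) (rep P η) (comulGen P g) := by
  rw [comulRep, AlgHom.comp_apply, comul_ug]

/-- The hypothesis on Γ is used only for $\omega_i$, $\omega_i'$, $e_i$ and $f_i$; commutation with
the inverses of $\omega_i,\omega_i'$ follows formally. -/
theorem twistedTrace_theta_mem_center (η : X.Weight)
    (Γ : QuantumGroup P ⊗[K] Module.End K (SimpleModule P η))
    (hΓ : ∀ x : QuantumGroup P, Γ * comulRep P η x = comulRep P η x * Γ) :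
    twistedTrace (theta P η) Γ ∈ Subalgebra.center K (QuantumGroup P) := by
  have hom : ∀ i, Γ * (ug P (.om i) ⊗ₜ[K] rep P η (ug P (.om i))) =
      (ug P (.om i) ⊗ₜ[K] rep P η (ug P (.om i))) * Γ := fun i => by
    simpa [comulRep_ug, comulGen] using hΓ (ug P (.om i))
  have homP : ∀ i, Γ * (ug P (.omP i) ⊗ₜ[K] rep P η (ug P (.omP i))) =
      (ug P (.omP i) ⊗ₜ[K] rep P η (ug P (.omP i))) * Γ := fun i => by
    simpa [comulRep_ug, comulGen] using hΓ (ug P (.omP i))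
  have r1 : ∀ i, rep P η (ug P (.om i)) * rep P η (ug P (.omInv i)) = 1 := fun i => by
    rw [← map_mul, om_mul_inv, map_one]
  have r2 : ∀ i, rep P η (ug P (.omInv i)) * rep P η (ug P (.om i)) = 1 := fun i => by
    rw [← map_mul, om_inv_mul, map_one]
  have r3 : ∀ i, rep P η (ug P (.omP i)) * rep P η (ug P (.omPInv i)) = 1 := fun i => by
    rw [← map_mul, omP_mul_inv, map_one]
  have r4 : ∀ i, rep P η (ug P (.omPInv i)) * rep P η (ug P (.omP i)) = 1 := fun i => by
    rw [← map_mul, omP_inv_mul, map_one]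
  have com : ∀ i, twistedTrace (theta P η) Γ * ug P (.om i) =
      ug P (.om i) * twistedTrace (theta P η) Γ := fun i =>
    commute_twistedTrace_of_groupLike (r1 i) (r2 i) (theta_mul_toral P η _ trivial) (hom i)
  have comP : ∀ i, twistedTrace (theta P η) Γ * ug P (.omP i) =
      ug P (.omP i) * twistedTrace (theta P η) Γ := fun i =>
    commute_twistedTrace_of_groupLike (r3 i) (r4 i) (theta_mul_toral P η _ trivial) (homP i)
  refine mem_center_of_commute_ug P fun g => ?_
  cases g with
  | e i =>
    -- Here $c=a_{ii}$, and both the relation for $\omega_i$ and the intertwining `hom i` enter.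
    refine commute_twistedTrace_of_skewPrimitive (r1 i) (r2 i)
      (theta_mul_toral P η (.om i) trivial) (P.a_ne_zero i i) (theta_mul_e P η i) ?_ (hom i) ?_
    · rw [← map_mul, om_e, map_smul, map_mul]
    · simpa [comulRep_ug, comulGen] using hΓ (ug P (.e i))
  | f i =>
    -- The group-like attached to $f_i$ is $\omega_i'$, and $\omega_i'f_i=a_{ii}f_i\omega_i'$ has
    -- the same factor as `theta_mul_f`.
    refine commute_twistedTrace_of_skewPrimitive' (r3 i) (r4 i)
      (theta_mul_toral P η (.omP i) trivial) (theta_mul_f P η i) ?_ ?_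
    · rw [← map_mul, omP_f, map_smul, map_mul]
    · simpa [comulRep_ug, comulGen] using hΓ (ug P (.f i))
  | om i => exact com i
  | omInv i => exact mul_inverse_comm (om_mul_inv P i) (om_inv_mul P i) (com i)
  | omP i => exact comP i
  | omPInv i => exact mul_inverse_comm (omP_mul_inv P i) (omP_inv_mul P i) (comP i)

end TwoParameter

end

theorem mainTheorem11 (X : TwoParameter.DynkinType) (K : Type*) [Field K] [CharZero K]
    (P : TwoParameter.Parameters X K) (lam : X.Weight) (hlam : X.IsDominant lam)
    (Γ : TensorProduct K (TwoParameter.QuantumGroup P)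
      (Module.End K (TwoParameter.SimpleModule P lam)))
    (hΓ : ∀ x : TwoParameter.QuantumGroup P,
      Γ * TwoParameter.comulRep P lam x = TwoParameter.comulRep P lam x * Γ) :
    TwoParameter.partialTrace P lam (Γ * (1 ⊗ₜ[K] TwoParameter.theta P lam)) ∈
      Subalgebra.center K (TwoParameter.QuantumGroup P) :=
  -- `twistedTrace` unfolds to right multiplication by `1 ⊗ Θ` followed by `partialTrace`, so the
  -- two expressions agree definitionally.
  TwoParameter.twistedTrace_theta_mem_center P lam Γ hΓ
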